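/- **Setting.** Let $I=\mathbb Z\times\{+1,-1\}$, $\langle (j,\sigma)\rangle=\max(|j|,1)$, $\mathfrak m_{(j,\sigma)}=\sigma j$, and let $\mathbb N^I_{\rm fin}$, $\mathbb Z^I_{\rm fin}$ be the finitely supported vectors. Put $|x|_s=\big(\sum_{k\in I}\langle k\rangle^2e^{2s\sqrt{\langle k\rangle}}|x_k|^2\big)^{1/2}$. For $s\ge 0$, $r>0$ let $\mathcal V_{s,r}$ be the space of vector fields $V=\sum_{k,q}V^{(k)}_q x^q\partial_{x_k}$ (power series, $q\in\mathbb N^I_{\rm fin}$) with $V(0)=0$, $V^{(k)}_q=0$ unless $\mathfrak m\cdot q=\mathfrak m_k$, and $\|V\|_{s,r}=\frac1r\sup_{|x|_s<r}\big|\big(\sum_q|V_q^{(k)}|\,|x|^q\big)_k\big|_s<\infty$, where $|x|^q=\prod_i|x_i|^{q_i}$. The degree of $x^q\partial_{x_k}$ is $\|q\|_{\ell^1}-1$, and $\mathcal V^{\ge d}_{s,r}$ consists of the fields with monomials of degree $\ge d$ only. Brackets $[X,Y]=\sum_j(X[Y^{(j)}]-Y[X^{(j)}])\partial_{x_j}$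 are taken in the sense of formal power series. For $\lambda\in\mathbb C^I$ let $D(\lambda)=\sum_k\lambda_kx_k\partial_{x_k}$, let $\mathcal K$ be the set of (momentum preserving) $V$ with $[D(\lambda),V]=0$, and $\mathcal K^{\rm diag}$ the set of $V\in\mathcal K$ containing only monomials $x^px_k\partial_{x_k}$, $p\in\mathbb N^I_{\rm fin}$. Let $\mathcal M_\lambda=\{Q\in\mathbb N^I_{\rm fin}: Q\cdot\lambda=0,\ Q\cdot\mathfrak m=0\}$, $\Delta^{(k)}_\lambda=\{P\in\mathbb Z^I_{\rm fin}: P\cdot\lambda=0,\ P\cdot\mathfrak m=0,\ P+e_k\in\mathbb N^I_{\rm fin}\}$, $\Delta_\lambda=\bigcup_k\Delta_\lambda^{(k)}$. Let $(Q_i)$ be the generators (indecomposable nonzero elements) of $\mathcal M_\lambda$, and $(P_j)$ the generators of $\Delta_\lambda\setminus\mathcal M_\lambda$, i.e. its elements not of the form $P'+Q$ with $P'\in\Delta_\lambda\setminus\mathcal M_\lambda$, $0\ne Q\in\mathcal M_\lambda$. Let $\mathcal J^{(1)}$ (resp. $\mathcal J^{(2)}$) be the set of $q\in\mathbb N^I_{\rm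 fin}$ with $q\ge Q_i$ for some $i$ (resp. $q\ge Q_i+Q_j$ for some $i,j$), componentwise. Let $\mathcal I^{(0)}$, $\mathcal I^{(1)}$ be the sets of (momentum preserving) vector fields containing only monomials $x^q\partial_{x_k}$ with $q\notin\mathcal J^{(1)}$, resp. $q\in\mathcal J^{(1)}\setminus\mathcal J^{(2)}$, and $\Pi^{\mathcal I^{(i)}}$ the corresponding projections on monomials. **Assumptions on $\lambda$.** (a) $\lambda_k\ne0$ for all $k$, and for some integers $M\ge1$, $M_1\ge 0$: $\|Q_i\|_{\ell^1}\le M$ for all $i$, and $\|P_j+e_k\|_{\ell^1}\le M_1$ whenever $P_j\in\Delta_\lambda^{(k)}$. (b) There are real $\varphi_k$ with $|\lambda_k-\langle k\rangle^2e^{{\rm i}\varphi_k}|\le\frac12$ for all $k$, and $|e^{{\rm i}\varphi_{(j,\sigma)}}-e^{{\rm i}\varphi_{(-j,-\sigma)}}|\ge C$ whenever $\lambda_{(j,\sigma)}\ne\lambda_{(-j,-\sigma)}$, where $C>0$. (c) $\lambda$ is $(\gamma,\tau)$-Diophantine modulo $\Delta_\lambda$, $\gamma>0$: $|\lambda\cdot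 p|\ge\gamma\prod_{i\in I}(1+p_i^2\langle i\rangle^2)^{-\tau}$ for all $p\in\mathbb Z^I_{\rm fin}\setminus\Delta_\lambda$ with $p\cdot\mathfrak m=0$ and $p+e_k\in\mathbb N^I_{\rm fin}$ for some $k$. Call $M_*\in\mathbb N$ a *threshold* for $\lambda$ if every element of $\mathcal I^{(0)}\cap\mathcal K$ or of $\mathcal I^{(1)}\cap\mathcal K$ all of whose monomials have degree $\ge M_*$ is zero. **Proposition 4.1 (Straightening the dynamics).** For every $C>0$ and $\tau\in\mathbb R$ there are constants $c,K>0$, depending only on $C$ and $\tau$, such that for all $\lambda,\gamma,M,M_1$ satisfying (a)–(c) the following holds. The number $2M+M_1$ is a threshold for $\lambda$. Moreover, let $M_*$ be any threshold for $\lambda$, $s\ge0$, $r>0$, $Z\in\mathcal K^{\rm diag}\cap\mathcal V^{\ge1}_{s,r}$, $i\in\{0,1\}$ and $Y_i\in\mathcal I^{(i)}\cap\mathcal V^{\ge M_*}_{s,r}$. Then there is $F_i$ such that for all $\sigma>0$ and $0<\rho<r$: $F_i$ belongs to $\mathcal I^{(i)}\cap\mathcal V^{\ge M_*}_{s+\sigma,r-\rho}$,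 it solves $$\Pi^{\mathcal I^{(i)}}[F_i,\,D(\lambda)+Z]=Y_i ,$$ it is the only solution in $\mathcal I^{(i)}\cap\mathcal V^{\ge M_*}_{s+\sigma,r-\rho}$, and $$\|F_i\|_{s+\sigma,r-\rho}\le K\,\frac r\rho\,\gamma^{-1}e^{2^7c/\sigma^6}\big(1+\gamma^{-1}\|Z\|_{s,r}\big)\|Y_i\|_{s,r}.$$ -/

import Mathlib

open scoped ENNReal

noncomputable section

namespace ResVF

/-! ### Indices, weights, momentum -/

/-- The index set `I = ℤ × {+1, -1}`. -/
abbrev Idx := ℤ × ℤˣ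

/-- The momentum `𝔪_{(j,σ)} = σ j`. -/
def mom (k : Idx) : ℤ := (k.2 : ℤ) * k.1

/-- `⟨(j,σ)⟩ = max(|j|, 1)`. -/
def jap (k : Idx) : ℝ := max |(k.1 : ℝ)| 1

/-- The weighted `ℓ²` norm `(∑ ⟨k⟩² e^{2 s √⟨k⟩} y_k²)^{1/2}` of a sequence of moduli. -/
def weightedNorm (s : ℝ) (y : Idx → ℝ≥0∞) : ℝ≥0∞ :=
  (∑' k, ENNReal.ofReal (jap k ^ 2 * Real.exp (2 * s * Real.sqrt (jap k))) * y k ^ 2) ^ (1 / 2 : ℝ)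

/-- The norm `|x|_s` of a complex sequence; `𝚐_s` is the set where it is finite. -/
def gNorm (s : ℝ) (x : Idx → ℂ) : ℝ≥0∞ := weightedNorm s (fun k => ‖x k‖ₑ)

/-! ### Formal vector fields and the spaces `𝒱_{s,r}` -/

/-- A formal vector field `V = ∑ V_q^{(k)} x^q ∂/∂x_k`, given by its components
`V^{(k)} ∈ ℂ⟦x_i, i ∈ I⟧`; an analytic vector field is identified with its power series. -/
abbrev FormalVF := Idx → MvPowerSeries Idx ℂ

/-- The coefficient `V_q^{(k)}` of `x^q ∂/∂x_k`. -/
def cf (V : FormalVF) (k : Idx) (q : Idx →₀ ℕ) : ℂ := MvPowerSeries.coeff q (V k)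

/-- `V_q^{(k)} = 0` unless `𝔪 · q = 𝔪_k`. -/
def MomentumPreserving (V : FormalVF) : Prop :=
  ∀ k q, cf V k q ≠ 0 → Finsupp.linearCombination ℕ mom q = mom k

/-- The majorant norm `‖V‖_{s,r} = r⁻¹ sup_{|x|_s < r} |∑ |V_q^{(k)}| x^q ∂/∂x_k|_s`, as an extended
nonnegative number. All coefficients of the majorant being nonnegative, the supremum over the
complex ball is the one over moduli, so `|x_i|` is substituted for `x_i`. -/
def majNorm (s r : ℝ) (V : FormalVF) : ℝ≥0∞ :=
  ENNReal.ofReal r⁻¹ * ⨆ (x : Idx → ℂ) (_ : gNorm s x < ENNReal.ofReal r),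
    weightedNorm s (fun k => ∑' q : Idx →₀ ℕ, ‖cf V k q‖ₑ * q.prod (fun i n => ‖x i‖ₑ ^ n))

/-- The space `𝒱_{s,r}`: `V(0) = 0`, momentum preserving, finite majorant norm. -/
structure MemV (s r : ℝ) (V : FormalVF) : Prop where
  zero : ∀ k, cf V k 0 = 0
  momentum : MomentumPreserving V
  finite : majNorm s r V < ⊤

/-- `V` has order at least `d`: only monomials `x^q ∂/∂x_k` of degree `|q| - 1 ≥ d` occur. -/
def OrderGE (d : ℕ) (V : FormalVF) : Prop :=
  ∀ k q, cf V k q ≠ 0 → d + 1 ≤ q.degree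

/-! ### Lie bracket, projections, diagonal fields -/

/-- The derivative `X[f] = ∑_k X^{(k)} ∂f/∂x_k`. If `X` is momentum preserving, then for each
`q` only finitely many `k` contribute to the coefficient of `x^q`, because for every
`a ≤ q` there are at most two `k` with `𝔪_k = 𝔪 · a`. -/
def applyVF (X : FormalVF) (f : MvPowerSeries Idx ℂ) : MvPowerSeries Idx ℂ :=
  fun q => ∑' k, MvPowerSeries.coeff q (X k * MvPowerSeries.pderiv ℂ k f)

/-- The Lie bracket `[X, Y] = ∑_j (X[Y^{(j)}] - Y[X^{(j)}]) ∂/∂x_j`. -/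
def lie (X Y : FormalVF) : FormalVF := fun j => applyVF X (Y j) - applyVF Y (X j)

open Classical in
/-- The projection keeping the monomials `x^q ∂/∂x_k` with `q ∈ J`. -/
def proj (J : Set (Idx →₀ ℕ)) (V : FormalVF) : FormalVF :=
  fun k q => if q ∈ J then cf V k q else 0

/-- `D(λ) = ∑_k λ_k x_k ∂/∂x_k`. -/
def diagField (lam : Idx → ℂ) : FormalVF :=
  fun k => MvPowerSeries.C (lam k) * MvPowerSeries.X k

/-- `V` lies in the kernel of `L_λ = [D(λ), ·]`. -/
def Resonant (lam : Idx → ℂ) (V : FormalVF) : Prop := lie (diagField lam) V = 0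

/-- `V` is diagonal: only monomials `x^p x_k ∂/∂x_k` occur. -/
def Diagonal (V : FormalVF) : Prop :=
  ∀ k q, cf V k q ≠ 0 → ∃ p : Idx →₀ ℕ, q = p + Finsupp.single k 1

/-! ### Resonances -/

/-- `ℳ_λ = {Q ∈ ℕ^I_fin : Q · λ = 0, Q · 𝔪 = 0}`. -/
def MLat (lam : Idx → ℂ) : Set (Idx →₀ ℕ) :=
  {Q | Finsupp.linearCombination ℕ lam Q = 0 ∧ Finsupp.linearCombination ℕ mom Q = 0}

/-- The generators `Q_i` of `ℳ_λ`: its indecomposable elements. -/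
def MGen (lam : Idx → ℂ) : Set (Idx →₀ ℕ) :=
  {Q | Q ∈ MLat lam ∧ Q ≠ 0 ∧
    ∀ Q₁ ∈ MLat lam, ∀ Q₂ ∈ MLat lam, Q = Q₁ + Q₂ → Q₁ = 0 ∨ Q₂ = 0}

/-- A finitely supported vector of naturals, seen in `ℤ^I_fin`. -/
def toInt (q : Idx →₀ ℕ) : Idx →₀ ℤ := q.mapRange (fun n : ℕ => (n : ℤ)) Nat.cast_zero

/-- `Δ_λ^{(k)} = {P ∈ ℤ^I_fin : P · λ = 0, P · 𝔪 = 0, P + e_k ∈ ℕ^I_fin}`. -/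
def DeltaAt (lam : Idx → ℂ) (k : Idx) : Set (Idx →₀ ℤ) :=
  {P | Finsupp.linearCombination ℤ lam P = 0 ∧ Finsupp.linearCombination ℤ mom P = 0 ∧
    0 ≤ P + Finsupp.single k 1}

/-- `Δ_λ = ⋃_k Δ_λ^{(k)}`. -/
def Delta (lam : Idx → ℂ) : Set (Idx →₀ ℤ) := ⋃ k, DeltaAt lam k

/-- `Δ_λ ∖ ℳ_λ`. -/
def DeltaOut (lam : Idx → ℂ) : Set (Idx →₀ ℤ) := Delta lam \ (toInt '' MLat lam)

/-- The generators `P_j` of `Δ_λ ∖ ℳ_λ` modulo translation by `ℳ_λ`: the elements that are not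
`P' + Q` with `P' ∈ Δ_λ ∖ ℳ_λ` and `0 ≠ Q ∈ ℳ_λ`. -/
def DeltaGen (lam : Idx → ℂ) : Set (Idx →₀ ℤ) :=
  {P | P ∈ DeltaOut lam ∧
    ∀ P' ∈ DeltaOut lam, ∀ Q ∈ MLat lam, P = P' + toInt Q → Q = 0}

/-- `‖Q_i‖_{ℓ¹} ≤ M` for all generators of `ℳ_λ`, and `‖P_j + e_k‖_{ℓ¹} ≤ M₁` for all generators
`P_j ∈ Δ_λ^{(k)}` of `Δ_λ ∖ ℳ_λ`. -/
def BoundedGenerators (lam : Idx → ℂ) (M M₁ : ℕ) : Prop :=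
  (∀ Q ∈ MGen lam, Q.degree ≤ M) ∧
  ∀ k, ∀ P ∈ DeltaGen lam, P ∈ DeltaAt lam k →
    (P + Finsupp.single k 1).sum (fun _ n => |n|) ≤ (M₁ : ℤ)

/-- Quadratic growth `|λ_k - ⟨k⟩² e^{iφ_k}| ≤ 1/2`, where the phases `e^{iφ_{(j,σ)}}` and
`e^{iφ_{(-j,-σ)}}` are at distance at least `C` whenever `λ_{(j,σ)} ≠ λ_{(-j,-σ)}`. -/
def Superlinear (C : ℝ) (lam : Idx → ℂ) : Prop :=
  ∃ φ : Idx → ℝ,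
    (∀ k, ‖lam k - (jap k : ℂ) ^ 2 * Complex.exp (Complex.I * φ k)‖ ≤ 1 / 2) ∧
    ∀ (j : ℤ) (σ : ℤˣ), lam (j, σ) ≠ lam (-j, -σ) →
      C ≤ ‖Complex.exp (Complex.I * φ (j, σ)) - Complex.exp (Complex.I * φ (-j, -σ))‖

/-- `λ` is `(γ, τ)`-Diophantine modulo `Δ_λ`. The factors with `p_i = 0` equal `1`. -/
def DiophantineMod (lam : Idx → ℂ) (γ τ : ℝ) : Prop :=
  ∀ p : Idx →₀ ℤ, p ∉ Delta lam → Finsupp.linearCombination ℤ mom p = 0 →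
    (∃ k, 0 ≤ p + Finsupp.single k 1) →
    γ * p.prod (fun i n => 1 / (1 + (n : ℝ) ^ 2 * jap i ^ 2) ^ τ)
      ≤ ‖Finsupp.linearCombination ℤ lam p‖

/-! ### The decomposition `𝒱 = ℐ⁽⁰⁾ ⊕ ℐ⁽¹⁾ ⊕ ℐ⁽²⁾` -/

/-- `𝒥⁽¹⁾`: exponents divisible by some `x^{Q_i}`. -/
def J1 (lam : Idx → ℂ) : Set (Idx →₀ ℕ) := {q | ∃ Q ∈ MGen lam, Q ≤ q}

/-- `𝒥⁽²⁾`: exponents divisible by some `x^{Q_i} x^{Q_j}`. -/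
def J2 (lam : Idx → ℂ) : Set (Idx →₀ ℕ) := {q | ∃ Q ∈ MGen lam, ∃ Q' ∈ MGen lam, Q + Q' ≤ q}

/-- The exponents of the monomials in `ℐ⁽ⁱ⁾` for `i = 0, 1`:
`𝒥⁽⁰⁾ = ℕ^I_fin ∖ 𝒥⁽¹⁾` and `𝒥⁽¹⁾ ∖ 𝒥⁽²⁾`. -/
def idealExp (lam : Idx → ℂ) : Fin 2 → Set (Idx →₀ ℕ) := ![(J1 lam)ᶜ, J1 lam \ J2 lam]

/-- `V` only involves monomials of `ℐ⁽ⁱ⁾`. -/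
def InIdeal (lam : Idx → ℂ) (i : Fin 2) (V : FormalVF) : Prop :=
  ∀ k q, cf V k q ≠ 0 → q ∈ idealExp lam i

/-- The degree threshold `M*`: `ℐ⁽⁰⁾ ∩ 𝒦^{≥ M*} = {0}` and `ℐ⁽¹⁾ ∩ 𝒦^{≥ M*} = {0}`. -/
def IsThreshold (lam : Idx → ℂ) (d : ℕ) : Prop :=
  ∀ (i : Fin 2) (V : FormalVF), MomentumPreserving V → InIdeal lam i V → Resonant lam V →
    OrderGE d V → V = 0

end ResVF

end

noncomputable section

namespace ResVF

open MvPowerSeries (coeff pderiv)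

/-! ### Coefficients of `X[f]` -/

/-! On `ℐ⁽ⁱ⁾` the operator `F ↦ Π [F, D(λ) + Z]` has the form `L + A`, where `L` multiplies the
coefficient of `x^q ∂_k` by `λ_k - λ · q` and `A F = Π (F[Z])`. The other half `Z[F]` of the bracket
drops out: every monomial of `Z` is `x^p x_k ∂_k` with `0 ≠ p ∈ ℳ_λ`, and multiplying by such an
`x^p` leaves the ideal (`cf_proj_lie`). In `F[Z]` the derivative may strip a variable off `x^p`, so
`A` need not vanish, but this cannot happen twice in a row: `A L⁻¹ A = 0`
(`proj_applyVF_proj_applyVF`). Hence `(L + A)⁻¹ = L⁻¹ - L⁻¹ A L⁻¹`, a formal solution (`homSol`)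
that knows nothing of `σ` and `ρ`; uniqueness is formal too.

Invertibility of `L` above a threshold is the threshold property applied to single monomials. That
`2M + M₁` is a threshold is combinatorial: a resonant exponent of larger degree contains two
generators of `ℳ_λ` (`mem_J2_of_resonant`).

The norm bound combines a Cauchy estimate for `A` (`majNorm_applyVF_le`) with a small divisor
estimate for `L⁻¹` (`exists_inv_divisor_le`). Momentum conservation gives a gain `σ(wt q - √⟨k⟩)` of
at least half the weight of all factors of `x^q` but the largest, `x_a` (`half_wt_le`). The
Diophantine bound also involves `⟨a⟩` and `⟨k⟩`; quadratic growth of `λ` and momentum bound these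
two by the remaining factors (`jap_le_of_superlinear`), unless `λ_a = λ_k` and `a` disappears from
the divisor. The remaining product is then absorbed by the gain, at the price `e^{c/σ⁶}`
(`japProd_rpow_le`). -/

theorem finite_setOf_mom_eq (m : ℤ) : {k : Idx | mom k = m}.Finite := by
  have h : {k : Idx | mom k = m} ⊆ Set.range fun u : ℤˣ => ((u : ℤ) * m, u) := by
    rintro ⟨j, u⟩ hk
    refine ⟨u, ?_⟩
    have hk' : (u : ℤ) * j = m := hk
    simp only [← hk', ← mul_assoc, ← Units.val_mul, Int.units_mul_self]
    simp
  exact (Set.finite_range _).subset h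

/-- Momentum conservation makes the `tsum` in `applyVF` a finite sum. Without summability it would
take the default value `0`, and additivity of the bracket could fail. -/
theorem finite_support_coeff_mul {X : FormalVF} (hX : MomentumPreserving X)
    (g : Idx → MvPowerSeries Idx ℂ) (q : Idx →₀ ℕ) :
    (Function.support fun k => coeff q (X k * g k)).Finite := by
  have h : (Function.support fun k => coeff q (X k * g k)) ⊆
      ⋃ a ∈ Finset.HasAntidiagonal.antidiagonal q, {k | mom k = Finsupp.linearCombination ℕ mom a.1} := by
    intro k hk
    rw [Function.mem_support, MvPowerSeries.coeff_mul] at hk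
    obtain ⟨a, ha, hne⟩ := Finset.exists_ne_zero_of_sum_ne_zero hk
    simp only [Set.mem_iUnion]
    exact ⟨a, ha, (hX k a.1 (left_ne_zero_of_mul hne)).symm⟩
  exact (Set.Finite.biUnion (Finset.finite_toSet _) fun a _ => finite_setOf_mom_eq _).subset h

theorem summable_coeff_mul {X : FormalVF} (hX : MomentumPreserving X)
    (g : Idx → MvPowerSeries Idx ℂ) (q : Idx →₀ ℕ) :
    Summable fun k => coeff q (X k * g k) :=
  summable_of_hasFiniteSupport (finite_support_coeff_mul hX g q)

theorem coeff_applyVF (X : FormalVF) (f : MvPowerSeries Idx ℂ) (q : Idx →₀ ℕ) :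
    coeff q (applyVF X f) = ∑' k, coeff q (X k * pderiv ℂ k f) := rfl

theorem applyVF_add_left {X X' : FormalVF} (hX : MomentumPreserving X)
    (hX' : MomentumPreserving X') (f : MvPowerSeries Idx ℂ) :
    applyVF (X + X') f = applyVF X f + applyVF X' f := by
  ext q
  simp only [map_add, coeff_applyVF, Pi.add_apply, add_mul]
  exact (summable_coeff_mul hX _ q).tsum_add (summable_coeff_mul hX' _ q)

theorem applyVF_sub_left {X X' : FormalVF} (hX : MomentumPreserving X)
    (hX' : MomentumPreserving X') (f : MvPowerSeries Idx ℂ) :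
    applyVF (X - X') f = applyVF X f - applyVF X' f := by
  ext q
  simp only [map_sub, coeff_applyVF, Pi.sub_apply, sub_mul]
  exact (summable_coeff_mul hX _ q).tsum_sub (summable_coeff_mul hX' _ q)

theorem applyVF_add_right {X : FormalVF} (hX : MomentumPreserving X)
    (f g : MvPowerSeries Idx ℂ) :
    applyVF X (f + g) = applyVF X f + applyVF X g := by
  ext q
  simp only [map_add, coeff_applyVF, mul_add]
  exact (summable_coeff_mul hX _ q).tsum_add (summable_coeff_mul hX _ q)

/-- `x^a ∂_k` sends `x^(b + e_k)` to a multiple of `x^(a + b)`. All statements below about momentum,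
order and ideals are read off from this shape. -/
theorem exists_of_coeff_applyVF_ne_zero {X : FormalVF} {f : MvPowerSeries Idx ℂ}
    {q : Idx →₀ ℕ} (h : coeff q (applyVF X f) ≠ 0) :
    ∃ (k : Idx) (a b : Idx →₀ ℕ), a + b = q ∧ cf X k a ≠ 0 ∧
      coeff (b + Finsupp.single k 1) f ≠ 0 := by
  rw [coeff_applyVF] at h
  obtain ⟨k, hk⟩ : ∃ k, coeff q (X k * pderiv ℂ k f) ≠ 0 := by
    by_contra! hc
    simp [hc] at h
  rw [MvPowerSeries.coeff_mul] at hk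
  obtain ⟨a, ha, hne⟩ := Finset.exists_ne_zero_of_sum_ne_zero hk
  rw [MvPowerSeries.coeff_pderiv] at hne
  exact ⟨k, a.1, a.2, Finset.HasAntidiagonal.mem_antidiagonal.mp ha, left_ne_zero_of_mul hne,
    left_ne_zero_of_mul (right_ne_zero_of_mul hne)⟩

/-! ### The diagonal field -/

theorem cf_diagField (lam : Idx → ℂ) (k : Idx) (q : Idx →₀ ℕ) :
    cf (diagField lam) k q = if q = Finsupp.single k 1 then lam k else 0 := by
  simp [cf, diagField, MvPowerSeries.coeff_C_mul, MvPowerSeries.coeff_X]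

theorem momentumPreserving_diagField (lam : Idx → ℂ) : MomentumPreserving (diagField lam) := by
  intro k q h
  rw [cf_diagField] at h
  have hq : q = Finsupp.single k 1 := by
    by_contra hq
    simp [hq] at h
  simp [hq]

theorem coeff_X_mul_pderiv (k : Idx) (f : MvPowerSeries Idx ℂ) (q : Idx →₀ ℕ) :
    coeff q (MvPowerSeries.X k * pderiv ℂ k f) = q k * coeff q f := by
  by_cases hq : q k = 0
  · rw [MvPowerSeries.coeff_mul, hq]
    simp only [Nat.cast_zero, zero_mul]
    refine Finset.sum_eq_zero fun a ha => ?_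
    rw [MvPowerSeries.coeff_X, if_neg, zero_mul]
    intro h1
    have h2 := DFunLike.congr_fun (Finset.HasAntidiagonal.mem_antidiagonal.mp ha) k
    rw [h1] at h2
    simp at h2
    omega
  · obtain ⟨b, rfl⟩ : ∃ b, q = b + Finsupp.single k 1 :=
      ⟨q - Finsupp.single k 1, (tsub_add_cancel_of_le (by
        rw [Finsupp.single_le_iff]; omega)).symm⟩
    rw [add_comm b, ← pow_one (MvPowerSeries.X k), MvPowerSeries.X_pow_eq,
      MvPowerSeries.coeff_add_monomial_mul, MvPowerSeries.coeff_pderiv, add_comm b]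
    simp
    ring

theorem coeff_applyVF_diagField (lam : Idx → ℂ) (f : MvPowerSeries Idx ℂ) (q : Idx →₀ ℕ) :
    coeff q (applyVF (diagField lam) f) = Finsupp.linearCombination ℕ lam q * coeff q f := by
  have h : ∀ k, coeff q (diagField lam k * pderiv ℂ k f) = q k • lam k * coeff q f := by
    intro k
    rw [diagField, mul_assoc, MvPowerSeries.coeff_C_mul, coeff_X_mul_pderiv]
    simp
    ring
  rw [coeff_applyVF, Finsupp.linearCombination_apply, Finsupp.sum, Finset.sum_mul,
    tsum_eq_sum (s := q.support)]
  · exact Finset.sum_congr rfl fun k _ => h k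
  · intro k hk
    rw [h k, Finsupp.notMem_support_iff.mp hk]
    simp

theorem applyVF_diagField (X : FormalVF) (lam : Idx → ℂ) (j : Idx) :
    applyVF X (diagField lam j) = MvPowerSeries.C (lam j) * X j := by
  ext q
  have h : ∀ k, pderiv ℂ k (diagField lam j) = if k = j then MvPowerSeries.C (lam j) else 0 := by
    intro k
    rw [diagField, Derivation.leibniz, MvPowerSeries.pderiv_C, MvPowerSeries.pderiv_X,
      smul_zero, add_zero, Pi.single_apply, smul_ite, smul_zero, smul_eq_mul, mul_one]
    simp only [eq_comm]
  rw [coeff_applyVF, tsum_eq_single j]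
  · rw [h, if_pos rfl, mul_comm]
  · intro k hk
    rw [h, if_neg hk, mul_zero, map_zero]

theorem Resonant.linearCombination_eq {lam : Idx → ℂ} {V : FormalVF} (hV : Resonant lam V)
    {k : Idx} {q : Idx →₀ ℕ} (h : cf V k q ≠ 0) :
    Finsupp.linearCombination ℕ lam q = lam k := by
  have h1 : coeff q (lie (diagField lam) V k) = 0 := by
    rw [show lie (diagField lam) V = 0 from hV]; rfl
  rw [lie, map_sub, coeff_applyVF_diagField, applyVF_diagField, MvPowerSeries.coeff_C_mul,
    ← sub_mul] at h1
  exact sub_eq_zero.mp ((mul_eq_zero.mp h1).resolve_right h)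

theorem resonant_of_linearCombination_eq {lam : Idx → ℂ} {V : FormalVF}
    (h : ∀ k q, cf V k q ≠ 0 → Finsupp.linearCombination ℕ lam q = lam k) : Resonant lam V := by
  funext k
  ext q
  rw [lie, map_sub, coeff_applyVF_diagField, applyVF_diagField, MvPowerSeries.coeff_C_mul,
    ← sub_mul]
  by_cases hc : cf V k q = 0
  · rw [show coeff q (V k) = 0 from hc]; simp
  · rw [h k q hc]; simp

/-! ### Momentum and order -/

theorem linearCombination_mom_of_add {k j : Idx} {a b : Idx →₀ ℕ}
    (ha : Finsupp.linearCombination ℕ mom a = mom k)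
    (hb : Finsupp.linearCombination ℕ mom (b + Finsupp.single k 1) = mom j) :
    Finsupp.linearCombination ℕ mom (a + b) = mom j := by
  simp only [map_add, Finsupp.linearCombination_single, one_smul] at hb ⊢
  omega

theorem MomentumPreserving.applyVF {X W : FormalVF} (hX : MomentumPreserving X)
    (hW : MomentumPreserving W) : MomentumPreserving fun j => applyVF X (W j) := by
  intro j q hq
  obtain ⟨k, a, b, rfl, ha, hb⟩ := exists_of_coeff_applyVF_ne_zero hq
  exact linearCombination_mom_of_add (hX k a ha) (hW j _ hb)

/-- `W` needs no order: differentiation removes one variable from a monomial that contains it, so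
the degree of the exponent coming from `X` never drops. -/
theorem OrderGE.applyVF {d : ℕ} {X W : FormalVF} (hX : OrderGE d X) : OrderGE d fun j => applyVF X (W j) := by
  intro j q hq
  obtain ⟨k, a, b, rfl, ha, hb⟩ := exists_of_coeff_applyVF_ne_zero hq
  have h1 := hX k a ha
  rw [map_add]
  omega

/-! ### Resonance lattices -/

theorem MLat.add {lam : Idx → ℂ} {P Q : Idx →₀ ℕ} (hP : P ∈ MLat lam) (hQ : Q ∈ MLat lam) :
    P + Q ∈ MLat lam := by
  obtain ⟨h1, h2⟩ := hP
  obtain ⟨h3, h4⟩ := hQ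
  constructor <;> simp [*]

theorem MLat.zero (lam : Idx → ℂ) : (0 : Idx →₀ ℕ) ∈ MLat lam := by
  constructor <;> simp

theorem degree_pos_of_ne_zero {q : Idx →₀ ℕ} (h : q ≠ 0) : 0 < q.degree :=
  Nat.pos_of_ne_zero fun h0 => h ((Finsupp.degree_eq_zero_iff q).mp h0)

theorem exists_MGen_add {lam : Idx → ℂ} {P : Idx →₀ ℕ} (hP : P ∈ MLat lam) (hP0 : P ≠ 0) :
    ∃ Q ∈ MGen lam, ∃ R ∈ MLat lam, P = Q + R := by
  induction hn : P.degree using Nat.strong_induction_on generalizing P with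
  | _ n ih =>
    by_cases hg : P ∈ MGen lam
    · exact ⟨P, hg, 0, MLat.zero lam, (add_zero P).symm⟩
    · have : ∃ Q₁ ∈ MLat lam, ∃ Q₂ ∈ MLat lam, P = Q₁ + Q₂ ∧ Q₁ ≠ 0 ∧ Q₂ ≠ 0 := by
        by_contra! hc
        exact hg ⟨hP, hP0, fun Q₁ h1 Q₂ h2 h => or_iff_not_imp_left.mpr (hc Q₁ h1 Q₂ h2 h)⟩
      obtain ⟨Q₁, h1, Q₂, h2, rfl, h10, h20⟩ := this
      have h3 := degree_pos_of_ne_zero h20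
      obtain ⟨Q, hQ, R, hR, h4⟩ := ih Q₁.degree (by rw [← hn, map_add]; omega) h1 h10 rfl
      exact ⟨Q, hQ, R + Q₂, MLat.add hR h2, by rw [h4, add_assoc]⟩

/-- An element longer than every generator is not itself a generator, so splitting one off leaves a
nonzero remainder, which contains a second one. -/
theorem MLat.mem_J2_of_degree {lam : Idx → ℂ} {M : ℕ} (hM : ∀ Q ∈ MGen lam, Q.degree ≤ M)
    {Q q : Idx →₀ ℕ} (hQ : Q ∈ MLat lam) (hQ0 : Q ≠ 0) (hdeg : M < Q.degree) (hq : Q ≤ q) :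
    q ∈ J2 lam := by
  obtain ⟨Q₁, h1, R, hR, rfl⟩ := exists_MGen_add hQ hQ0
  have hR0 : R ≠ 0 := by
    rintro rfl
    have := hM Q₁ h1
    simp at hdeg
    omega
  obtain ⟨Q₂, h2, R', -, rfl⟩ := exists_MGen_add hR hR0
  refine ⟨Q₁, h1, Q₂, h2, le_trans ?_ hq⟩
  rw [← add_assoc]
  exact le_self_add

theorem J2_subset_J1 (lam : Idx → ℂ) : J2 lam ⊆ J1 lam := by
  rintro q ⟨Q, hQ, Q', -, h⟩
  exact ⟨Q, hQ, le_trans le_self_add h⟩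

theorem notMem_J2_of_mem_idealExp {lam : Idx → ℂ} {i : Fin 2} {q : Idx →₀ ℕ}
    (h : q ∈ idealExp lam i) : q ∉ J2 lam := by
  fin_cases i
  · exact fun h2 => h (J2_subset_J1 lam h2)
  · exact h.2

/-- The ideals grade exponents by how many generators they contain, and `p` supplies one more: from
none to at least one, or from one to at least two. -/
theorem notMem_idealExp_of_add_le {lam : Idx → ℂ} {i : Fin 2} {a p q : Idx →₀ ℕ}
    (ha : a ∈ idealExp lam i) (hp : p ∈ MLat lam) (hp0 : p ≠ 0) (h : a + p ≤ q) :
    q ∉ idealExp lam i := by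
  obtain ⟨Q, hQ, R, -, rfl⟩ := exists_MGen_add hp hp0
  fin_cases i
  · refine fun hq => hq ⟨Q, hQ, le_trans ?_ h⟩
    exact le_trans le_self_add le_add_self
  · obtain ⟨⟨Q', hQ', hle⟩, -⟩ := ha
    refine fun hq => hq.2 ⟨Q', hQ', Q, hQ, le_trans ?_ h⟩
    exact add_le_add hle le_self_add

/-! ### The degree threshold -/

theorem toInt_apply (q : Idx →₀ ℕ) (k : Idx) : toInt q k = (q k : ℤ) := rfl

theorem toInt_nonneg (q : Idx →₀ ℕ) : 0 ≤ toInt q := fun k => Int.natCast_nonneg (q k)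

theorem toInt_injective : Function.Injective toInt := fun a b h => by
  ext k
  have := DFunLike.congr_fun h k
  simp only [toInt_apply] at this
  exact_mod_cast this

theorem toInt_add (a b : Idx →₀ ℕ) : toInt (a + b) = toInt a + toInt b := by
  ext k
  simp [toInt_apply]

theorem toInt_single (k : Idx) : toInt (Finsupp.single k 1) = Finsupp.single k 1 := by
  simp [toInt]

theorem linearCombination_toInt {E : Type*} [AddCommGroup E] (v : Idx → E) (q : Idx →₀ ℕ) :
    Finsupp.linearCombination ℤ v (toInt q) = Finsupp.linearCombination ℕ v q := by
  rw [Finsupp.linearCombination_apply, Finsupp.linearCombination_apply, toInt,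
    Finsupp.sum_mapRange_index (by simp)]
  simp

theorem degree_eq_sum_abs_toInt (q : Idx →₀ ℕ) :
    (toInt q).sum (fun _ n => |n|) = (q.degree : ℤ) := by
  rw [toInt, Finsupp.sum_mapRange_index (by simp), Finsupp.degree_apply]
  simp [Finsupp.sum]

theorem exists_toInt_eq {p : Idx →₀ ℤ} (h : 0 ≤ p) : ∃ q, toInt q = p := by
  refine ⟨p.mapRange Int.toNat rfl, ?_⟩
  ext k
  simpa [toInt_apply] using h k

/-- A resonant exponent of degree above the threshold is divisible by two generators. -/
theorem mem_J2_of_resonant {lam : Idx → ℂ} {M M₁ : ℕ} (hM0 : 0 < M)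
    (hB : BoundedGenerators lam M M₁) {k : Idx} {q : Idx →₀ ℕ}
    (hlam : Finsupp.linearCombination ℕ lam q = lam k)
    (hmom : Finsupp.linearCombination ℕ mom q = mom k) (hdeg : 2 * M + M₁ + 1 ≤ q.degree) :
    q ∈ J2 lam := by
  by_cases hqk : q k = 0
  swap
  · obtain ⟨P, rfl⟩ : ∃ b, q = b + Finsupp.single k 1 :=
      ⟨q - Finsupp.single k 1, (tsub_add_cancel_of_le (by
        rw [Finsupp.single_le_iff]; omega)).symm⟩
    have hP : P ∈ MLat lam := by
      constructor
      · simpa using hlam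
      · simpa using hmom
    have hd : 2 * M ≤ P.degree := by
      rw [map_add, Finsupp.degree_single] at hdeg
      omega
    exact MLat.mem_J2_of_degree hB.1 hP (by rintro rfl; simp at hd; omega) (by omega) le_self_add
  classical
  -- Remove from `q` a resonant part `Q` leaving a remainder `R` of minimal degree. Minimality will
  -- make `R - e_k` a generator of `Δ_λ ∖ ℳ_λ`, so that `R` has degree at most `M₁` and all the
  -- excess lies in `Q`.
  have hex : ∃ n, ∃ Q ∈ MLat lam, Q ≤ q ∧ q.degree = n + Q.degree :=
    ⟨q.degree, 0, MLat.zero lam, zero_le, by simp⟩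
  obtain ⟨Q, hQ, hQq, hn⟩ := Nat.find_spec hex
  have hmin := fun m hm => Nat.find_min (H := hex) (m := m) hm
  generalize Nat.find hex = n at hn hmin
  obtain ⟨R, rfl⟩ := exists_add_of_le hQq
  have hRn : R.degree = n := by rw [map_add] at hn; omega
  set P : Idx →₀ ℤ := toInt R - Finsupp.single k 1 with hPdef
  have hRk : R k = 0 := by simp at hqk; exact hqk.2
  have hPR : P + Finsupp.single k 1 = toInt R := sub_add_cancel _ _
  have hPD : P ∈ DeltaAt lam k := by
    refine ⟨?_, ?_, ?_⟩
    · rw [hPdef, map_sub, linearCombination_toInt]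
      rw [map_add, hQ.1, zero_add] at hlam
      simp [hlam]
    · rw [hPdef, map_sub, linearCombination_toInt]
      rw [map_add, hQ.2, zero_add] at hmom
      simp [hmom]
    · rw [hPR]
      exact toInt_nonneg R
  -- Since `R k = 0`, the entry of `P` at `k` is `-1`. A negative entry there keeps `P` out of `ℳ_λ`
  -- and forces every `P' ≤ P` in `Δ_λ` to belong to `Δ_λ^{(k)}` with the same `k`.
  have hneg : ∀ P' : Idx →₀ ℤ, P' ≤ P → P' k < 0 := by
    intro P' h
    have h1 := h k
    simp [hPdef, toInt_apply, hRk] at h1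
    omega
  have hPgen : P ∈ DeltaGen lam := by
    refine ⟨⟨Set.mem_iUnion.mpr ⟨k, hPD⟩, ?_⟩, ?_⟩
    · rintro ⟨S, -, hS⟩
      have := hneg P le_rfl
      rw [← hS, toInt_apply] at this
      omega
    · rintro P' ⟨hP', -⟩ S hS hPS
      obtain ⟨k', hk'⟩ := Set.mem_iUnion.mp hP'
      have hle : P' ≤ P := by
        rw [hPS]
        intro j
        simp [toInt_apply]
      have hkk : k' = k := by
        by_contra hne
        have h1 := hk'.2.2 k
        have h2 := hneg P' hle
        simp [hne] at h1
        omega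
      subst hkk
      obtain ⟨R', hR'⟩ := exists_toInt_eq hk'.2.2
      have hRS : R = R' + S := by
        apply toInt_injective
        rw [← hPR, hPS, toInt_add, hR']
        abel
      by_contra hS0
      have hSpos := degree_pos_of_ne_zero hS0
      rw [hRS, map_add] at hRn
      -- A nonzero `S` could be moved from `R` into `Q`, contradicting minimality.
      refine hmin R'.degree (by omega) ⟨Q + S, MLat.add hQ hS, ?_, ?_⟩
      · rw [hRS, add_comm R' S, ← add_assoc]
        exact le_self_add
      · rw [hRS]
        simp only [map_add]
        omega
  have h1 := hB.2 k P hPgen hPD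
  rw [hPR, degree_eq_sum_abs_toInt] at h1
  rw [map_add] at hdeg
  have hQd : M < Q.degree := by omega
  exact MLat.mem_J2_of_degree hB.1 hQ (by rintro rfl; simp at hQd) hQd hQq

theorem isThreshold_of_boundedGenerators {lam : Idx → ℂ} {M M₁ : ℕ} (hM0 : 0 < M)
    (hB : BoundedGenerators lam M M₁) : IsThreshold lam (2 * M + M₁) := by
  intro i V hmom hI hres hord
  funext k
  ext q
  by_contra hc
  have hc' : cf V k q ≠ 0 := hc
  exact notMem_J2_of_mem_idealExp (hI k q hc')
    (mem_J2_of_resonant hM0 hB (hres.linearCombination_eq hc') (hmom k q hc') (hord k q hc'))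

/-- The threshold property, tested on the single monomial `x^q ∂_k`, says that no divisor vanishes.
-/
theorem IsThreshold.linearCombination_ne {lam : Idx → ℂ} {d : ℕ} (hd : IsThreshold lam d)
    {i : Fin 2} {k : Idx} {q : Idx →₀ ℕ} (hq : q ∈ idealExp lam i)
    (hmom : Finsupp.linearCombination ℕ mom q = mom k) (hdeg : d + 1 ≤ q.degree) :
    Finsupp.linearCombination ℕ lam q ≠ lam k := by
  intro hlam
  classical
  let V : FormalVF := fun j p => if j = k ∧ p = q then 1 else 0
  have hV : ∀ j p, cf V j p ≠ 0 → j = k ∧ p = q := by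
    intro j p h
    by_contra hc
    exact h (if_neg hc)
  have h0 : V = 0 := by
    refine hd i V ?_ ?_ (resonant_of_linearCombination_eq ?_) ?_ <;> intro j p h <;>
      obtain ⟨rfl, rfl⟩ := hV j p h <;> assumption
  have h1 : V k q = 1 := if_pos ⟨rfl, rfl⟩
  rw [h0] at h1
  exact zero_ne_one h1

/-! ### The structure of the homological operator -/

section Homological

variable {lam : Idx → ℂ} {Z : FormalVF}

theorem exists_MLat_of_diagonal (hmom : MomentumPreserving Z) (hres : Resonant lam Z)
    (hdiag : Diagonal Z) (hord : OrderGE 1 Z) {k : Idx} {q : Idx →₀ ℕ} (h : cf Z k q ≠ 0) :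
    ∃ p ∈ MLat lam, p ≠ 0 ∧ q = p + Finsupp.single k 1 := by
  obtain ⟨p, rfl⟩ := hdiag k q h
  refine ⟨p, ⟨?_, ?_⟩, ?_, rfl⟩
  · simpa using hres.linearCombination_eq h
  · simpa using hmom k _ h
  · rintro rfl
    simpa using hord k _ h

/-- The operator `F ↦ Π [F, D(λ)]` acts diagonally, and `Z[F]` does not contribute. -/
theorem cf_proj_lie {i : Fin 2} {F : FormalVF} (hF : MomentumPreserving F)
    (hFI : InIdeal lam i F) (hmom : MomentumPreserving Z)
    (hZ : ∀ k q, cf Z k q ≠ 0 → ∃ p ∈ MLat lam, p ≠ 0 ∧ q = p + Finsupp.single k 1)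
    (j : Idx) (q : Idx →₀ ℕ) :
    cf (proj (idealExp lam i) (lie F (diagField lam + Z))) j q =
      (lam j - Finsupp.linearCombination ℕ lam q) * cf F j q +
        cf (proj (idealExp lam i) fun j => applyVF F (Z j)) j q := by
  classical
  have hcf : ∀ (V : FormalVF), cf (proj (idealExp lam i) V) j q =
      if q ∈ idealExp lam i then cf V j q else 0 := fun _ => rfl
  rw [hcf, hcf]
  split_ifs with hq
  -- Here `q = (b + e_k) + p` with `b + e_k` an exponent of `F` and `p ≠ 0` resonant, so `q` has
  -- left the ideal.
  · have hZF : coeff q (applyVF Z (F j)) = 0 := by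
      by_contra hne
      obtain ⟨k, a, b, rfl, ha, hb⟩ := exists_of_coeff_applyVF_ne_zero hne
      obtain ⟨p, hp, hp0, rfl⟩ := hZ k a ha
      refine notMem_idealExp_of_add_le (hFI j _ hb) hp hp0 (le_of_eq ?_) hq
      abel
    simp only [cf, lie, Pi.add_apply]
    rw [applyVF_add_right hF, applyVF_add_left (momentumPreserving_diagField lam) hmom, map_sub,
      map_add, map_add, coeff_applyVF_diagField, applyVF_diagField, MvPowerSeries.coeff_C_mul, hZF]
    ring
  · have : cf F j q = 0 := by
      by_contra hne
      exact hq (hFI j q hne)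
    simp [this]

/-- Two successive applications of `F ↦ Π (F[Z])`, with a diagonal multiplier in between, give
zero. -/
theorem proj_applyVF_proj_applyVF {i : Fin 2} {F W : FormalVF} (hFI : InIdeal lam i F)
    (hZ : ∀ k q, cf Z k q ≠ 0 → ∃ p ∈ MLat lam, p ≠ 0 ∧ q = p + Finsupp.single k 1)
    (hW : ∀ k q, cf W k q ≠ 0 →
      cf (proj (idealExp lam i) fun j => applyVF F (Z j)) k q ≠ 0) :
    proj (idealExp lam i) (fun j => applyVF W (Z j)) = 0 := by
  classical
  funext j
  ext q
  change (if q ∈ idealExp lam i then coeff q (applyVF W (Z j)) else 0) = 0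
  split_ifs with hq
  swap
  · rfl
  by_contra hne
  obtain ⟨k, a, b, rfl, ha, hb⟩ := exists_of_coeff_applyVF_ne_zero hne
  have ha' : (if a ∈ idealExp lam i then coeff a (applyVF F (Z k)) else 0) ≠ 0 := hW k a ha
  split_ifs at ha' with haI
  swap
  · exact ha' rfl
  obtain ⟨l, a₁, b₁, rfl, ha₁, hb₁⟩ := exists_of_coeff_applyVF_ne_zero ha'
  obtain ⟨p, hp, hp0, hpe⟩ := hZ j _ hb
  obtain ⟨p₁, hp₁, hp₁0, hpe₁⟩ := hZ k _ hb₁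
  have ha₁I := hFI l a₁ ha₁
  -- If `l = k`, the first application already multiplies `x^{a₁}` by the whole `x^{p₁}`. If `l ≠
  -- k`, then `b₁` contains `e_k`, which restores the variable removed by the second derivative; the
  -- final exponent thus contains `a₁ + p`.
  by_cases hlk : l = k
  · subst hlk
    rw [add_left_injective _ hpe₁] at haI
    exact notMem_idealExp_of_add_le ha₁I hp₁ hp₁0 le_rfl haI
  · have hk : 1 ≤ b₁ k := by
      have := DFunLike.congr_fun hpe₁ k
      simp [hlk] at this
      omega
    refine notMem_idealExp_of_add_le ha₁I hp hp0 ?_ hq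
    rw [add_assoc]
    gcongr
    calc p ≤ p + Finsupp.single j 1 := le_self_add
      _ = b + Finsupp.single k 1 := hpe.symm
      _ ≤ b + b₁ := by gcongr; rwa [Finsupp.single_le_iff]
      _ = b₁ + b := add_comm _ _

end Homological

/-! ### The weighted norm -/

theorem jap_one_le (k : Idx) : 1 ≤ jap k := le_max_right _ _

theorem jap_pos (k : Idx) : 0 < jap k := lt_of_lt_of_le one_pos (jap_one_le k)

theorem weightedNorm_mono (s : ℝ) {y z : Idx → ℝ≥0∞} (h : ∀ k, y k ≤ z k) :
    weightedNorm s y ≤ weightedNorm s z := by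
  unfold weightedNorm
  gcongr with k
  exact h k

theorem weightedNorm_const_mul (s : ℝ) (c : ℝ≥0∞) (y : Idx → ℝ≥0∞) :
    weightedNorm s (fun k => c * y k) = c * weightedNorm s y := by
  unfold weightedNorm
  have h : ∀ k, ENNReal.ofReal (jap k ^ 2 * Real.exp (2 * s * Real.sqrt (jap k))) * (c * y k) ^ 2 =
      c ^ 2 * (ENNReal.ofReal (jap k ^ 2 * Real.exp (2 * s * Real.sqrt (jap k))) * y k ^ 2) := by
    intro k
    ring
  simp_rw [h]
  rw [ENNReal.tsum_mul_left, ENNReal.mul_rpow_of_nonneg _ _ (by norm_num), ← ENNReal.rpow_natCast,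
    ← ENNReal.rpow_mul]
  norm_num

/-- An `L²` norm for counting measure, which gives access to Minkowski's inequality; with the
σ-algebra `⊤` every function is measurable. -/
theorem weightedNorm_eq_lintegral (s : ℝ) (y : Idx → ℝ≥0∞) :
    weightedNorm s y = (∫⁻ k, (ENNReal.ofReal (jap k * Real.exp (s * Real.sqrt (jap k))) * y k)
      ^ (2 : ℝ) ∂(@MeasureTheory.Measure.count Idx ⊤)) ^ (1 / 2 : ℝ) := by
  let _ : MeasurableSpace Idx := ⊤
  have : MeasurableSingletonClass Idx := ⟨fun _ => trivial⟩
  rw [MeasureTheory.lintegral_count]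
  unfold weightedNorm
  congr 1
  refine tsum_congr fun k => ?_
  have h0 := jap_pos k
  rw [ENNReal.rpow_ofNat, mul_pow, ← ENNReal.ofReal_pow (by positivity), mul_pow,
    ← Real.exp_nat_mul]
  congr 3
  push_cast
  ring_nf

theorem weightedNorm_add_le (s : ℝ) (y z : Idx → ℝ≥0∞) :
    weightedNorm s (fun k => y k + z k) ≤ weightedNorm s y + weightedNorm s z := by
  let _ : MeasurableSpace Idx := ⊤
  simp only [weightedNorm_eq_lintegral, mul_add]
  exact ENNReal.lintegral_Lp_add_le (μ := MeasureTheory.Measure.count)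
    (measurable_from_top.aemeasurable) (measurable_from_top.aemeasurable) (by norm_num)

theorem weightedNorm_shift (s σ : ℝ) (y : Idx → ℝ≥0∞) :
    weightedNorm s (fun k => ENNReal.ofReal (Real.exp (σ * Real.sqrt (jap k))) * y k) =
      weightedNorm (s + σ) y := by
  unfold weightedNorm
  congr 1
  refine tsum_congr fun k => ?_
  rw [mul_pow, ← mul_assoc, ← ENNReal.ofReal_pow (by positivity),
    ← ENNReal.ofReal_mul (by positivity), mul_assoc, ← Real.exp_nat_mul, ← Real.exp_add]
  congr 4
  push_cast
  ring

theorem apply_le_weightedNorm {s : ℝ} (k : Idx) (y : Idx → ℝ≥0∞) :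
    ENNReal.ofReal (jap k * Real.exp (s * Real.sqrt (jap k))) * y k ≤ weightedNorm s y := by
  have h0 := jap_pos k
  have h := ENNReal.le_tsum (f := fun k =>
    ENNReal.ofReal (jap k ^ 2 * Real.exp (2 * s * Real.sqrt (jap k))) * y k ^ 2) k
  have h1 := ENNReal.rpow_le_rpow h (show (0 : ℝ) ≤ 1 / 2 by norm_num)
  refine le_trans (le_of_eq ?_) h1
  have h2 : ENNReal.ofReal (jap k ^ 2 * Real.exp (2 * s * Real.sqrt (jap k))) * y k ^ 2 =
      (ENNReal.ofReal (jap k * Real.exp (s * Real.sqrt (jap k))) * y k) ^ 2 := by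
    rw [mul_pow, ← ENNReal.ofReal_pow (by positivity), mul_pow, ← Real.exp_nat_mul]
    congr 3
    push_cast
    ring_nf
  rw [h2, ← ENNReal.rpow_natCast, ← ENNReal.rpow_mul]
  norm_num

theorem apply_ne_top_of_weightedNorm {s : ℝ} {y : Idx → ℝ≥0∞} (h : weightedNorm s y ≠ ⊤)
    (k : Idx) : y k ≠ ⊤ := by
  intro hk
  have h1 := apply_le_weightedNorm (s := s) k y
  have h0 := jap_pos k
  rw [hk, ENNReal.mul_top (by rw [Ne, ENNReal.ofReal_eq_zero, not_le]; positivity)] at h1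
  exact h (top_le_iff.mp h1)

theorem eq_zero_of_weightedNorm_eq_zero {s : ℝ} {y : Idx → ℝ≥0∞} (h : weightedNorm s y = 0)
    (k : Idx) : y k = 0 := by
  have h1 := apply_le_weightedNorm (s := s) k y
  have h0 := jap_pos k
  rw [h, nonpos_iff_eq_zero, mul_eq_zero, ENNReal.ofReal_eq_zero, ← not_lt] at h1
  exact h1.resolve_left (not_not.mpr (by positivity))

/-! ### Majorants -/

/-- The monomial `y^q`. -/
def mono (y : Idx → ℝ≥0∞) (q : Idx →₀ ℕ) : ℝ≥0∞ := q.prod fun i n => y i ^ n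

/-- The majorant `∑ |V_q^{(k)}| y^q`. -/
def Maj (V : FormalVF) (y : Idx → ℝ≥0∞) (k : Idx) : ℝ≥0∞ := ∑' q, ‖cf V k q‖ₑ * mono y q

theorem mono_add (y : Idx → ℝ≥0∞) (a b : Idx →₀ ℕ) : mono y (a + b) = mono y a * mono y b :=
  Finsupp.prod_add_index' (by simp) (fun _ _ _ => pow_add _ _ _)

theorem mono_single (y : Idx → ℝ≥0∞) (i : Idx) : mono y (Finsupp.single i 1) = y i := by
  simp [mono]

theorem mono_mul (y z : Idx → ℝ≥0∞) (q : Idx →₀ ℕ) :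
    mono (fun k => y k * z k) q = mono y q * mono z q := by
  simp [mono, mul_pow, Finsupp.prod_mul]

theorem mono_const (c : ℝ≥0∞) (q : Idx →₀ ℕ) : mono (fun _ => c) q = c ^ q.degree := by
  rw [mono, Finsupp.prod, Finset.prod_pow_eq_pow_sum, Finsupp.degree_apply]

/-- A point of finite weighted norm has finite entries, hence is the sequence of moduli of a complex
point. This lets all later estimates run over `ℝ≥0∞`. -/
theorem Maj_le_of_gNorm_lt {s r : ℝ} (hr : 0 < r) (V : FormalVF) {y : Idx → ℝ≥0∞}
    (hy : weightedNorm s y < ENNReal.ofReal r) :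
    weightedNorm s (Maj V y) ≤ ENNReal.ofReal r * majNorm s r V := by
  set x : Idx → ℂ := fun k => ((y k).toReal : ℂ)
  have hx : ∀ k, ‖x k‖ₑ = y k := by
    intro k
    have : ‖x k‖ₑ = ‖(y k).toReal‖ₑ := by
      rw [← ofReal_norm, ← ofReal_norm, Complex.norm_real]
    rw [this, Real.enorm_eq_ofReal ENNReal.toReal_nonneg,
      ENNReal.ofReal_toReal (apply_ne_top_of_weightedNorm hy.ne_top k)]
  have hg : gNorm s x < ENNReal.ofReal r := by
    unfold gNorm
    simpa only [hx] using hy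
  unfold majNorm
  rw [← mul_assoc, ← ENNReal.ofReal_mul hr.le, mul_inv_cancel₀ hr.ne', ENNReal.ofReal_one, one_mul]
  refine le_trans (le_of_eq ?_) (le_iSup₂ (f := fun (x : Idx → ℂ)
    (_ : gNorm s x < ENNReal.ofReal r) => weightedNorm s (fun k => ∑' q : Idx →₀ ℕ,
      ‖cf V k q‖ₑ * q.prod (fun i n => ‖x i‖ₑ ^ n))) x hg)
  simp only [hx]
  rfl

theorem majNorm_le {s r : ℝ} (hr : 0 < r) {V : FormalVF} {B : ℝ≥0∞}
    (h : ∀ y : Idx → ℝ≥0∞, weightedNorm s y < ENNReal.ofReal r →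
      weightedNorm s (Maj V y) ≤ ENNReal.ofReal r * B) : majNorm s r V ≤ B := by
  unfold majNorm
  calc _ ≤ ENNReal.ofReal r⁻¹ * (ENNReal.ofReal r * B) := by
        gcongr
        exact iSup₂_le fun x hx => h _ hx
    _ = B := by
        rw [← mul_assoc, ← ENNReal.ofReal_mul (by positivity), inv_mul_cancel₀ hr.ne',
          ENNReal.ofReal_one, one_mul]

theorem majNorm_sub_le {s r : ℝ} (hr : 0 < r) (V W : FormalVF) :
    majNorm s r (V - W) ≤ majNorm s r V + majNorm s r W := by
  refine majNorm_le hr fun y hy => ?_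
  rw [mul_add]
  refine le_trans (le_trans (weightedNorm_mono s fun k => ?_) (weightedNorm_add_le s (Maj V y)
    (Maj W y))) (add_le_add (Maj_le_of_gNorm_lt hr V hy) (Maj_le_of_gNorm_lt hr W hy))
  unfold Maj
  rw [← ENNReal.tsum_add]
  gcongr with q
  rw [← add_mul]
  gcongr
  simp only [cf, Pi.sub_apply, map_sub]
  exact enorm_sub_le

/-- The weight `∑ q_i √⟨i⟩` of an exponent. -/
def wt (q : Idx →₀ ℕ) : ℝ := q.sum fun i n => n * Real.sqrt (jap i)

theorem wt_add (a b : Idx →₀ ℕ) : wt (a + b) = wt a + wt b :=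
  Finsupp.sum_add_index' (by simp) (by intros; push_cast; ring)

theorem wt_single (i : Idx) : wt (Finsupp.single i 1) = Real.sqrt (jap i) := by
  simp [wt]

theorem wt_nonneg (q : Idx →₀ ℕ) : 0 ≤ wt q :=
  Finset.sum_nonneg fun _ _ => by positivity

theorem mono_exp (σ : ℝ) (q : Idx →₀ ℕ) :
    mono (fun k => ENNReal.ofReal (Real.exp (σ * Real.sqrt (jap k)))) q =
      ENNReal.ofReal (Real.exp (σ * wt q)) := by
  rw [mono, wt, Finsupp.prod, Finsupp.sum, Finset.mul_sum, Real.exp_sum,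
    ENNReal.ofReal_prod_of_nonneg (fun _ _ => (Real.exp_pos _).le)]
  refine Finset.prod_congr rfl fun i _ => ?_
  rw [← ENNReal.ofReal_pow (Real.exp_pos _).le, ← Real.exp_nat_mul]
  congr 2
  ring

/-- A coefficientwise bound with exponential gain bounds the majorant norm with loss of `σ`. -/
theorem majNorm_le_of_coeff_le {s r σ : ℝ} (hr : 0 < r) {V W : FormalVF} {B : ℝ}
    (hB : 0 ≤ B)
    (h : ∀ k q, cf W k q ≠ 0 →
      ‖cf W k q‖ ≤ B * Real.exp (σ * (wt q - Real.sqrt (jap k))) * ‖cf V k q‖) :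
    majNorm (s + σ) r W ≤ ENNReal.ofReal B * majNorm s r V := by
  refine majNorm_le hr fun y hy => ?_
  -- The rescaling `y_k ↦ e^{σ√⟨k⟩} y_k` carries the `s + σ` ball to the `s` ball. The monomial
  -- `y^q` acquires `e^{σ wt q}` and the component `k` carries `e^{σ√⟨k⟩}`; their quotient is the
  -- factor in `h`.
  rw [← weightedNorm_shift] at hy ⊢
  rw [mul_left_comm]
  refine le_trans ?_ (mul_le_mul_right (Maj_le_of_gNorm_lt hr V hy) _)
  rw [← weightedNorm_const_mul]
  refine weightedNorm_mono s fun k => ?_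
  unfold Maj
  rw [← ENNReal.tsum_mul_left, ← ENNReal.tsum_mul_left]
  refine ENNReal.tsum_le_tsum fun q => ?_
  rw [mono_mul, mono_exp]
  by_cases hc : cf W k q = 0
  · simp [hc]
  have h1 := h k q hc
  have h2 : ENNReal.ofReal (Real.exp (σ * Real.sqrt (jap k))) * ‖cf W k q‖ₑ ≤
      ENNReal.ofReal B * ‖cf V k q‖ₑ * ENNReal.ofReal (Real.exp (σ * wt q)) := by
    rw [← ofReal_norm, ← ofReal_norm, ← ENNReal.ofReal_mul (by positivity),
      ← ENNReal.ofReal_mul (by positivity), ← ENNReal.ofReal_mul (by positivity)]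
    refine ENNReal.ofReal_le_ofReal ?_
    calc _ ≤ Real.exp (σ * Real.sqrt (jap k)) *
          (B * Real.exp (σ * (wt q - Real.sqrt (jap k))) * ‖cf V k q‖) := by gcongr
      _ = B * ‖cf V k q‖ * (Real.exp (σ * Real.sqrt (jap k)) *
          Real.exp (σ * (wt q - Real.sqrt (jap k)))) := by ring
      _ = _ := by
        rw [← Real.exp_add]
        ring_nf
  calc _ = (ENNReal.ofReal (Real.exp (σ * Real.sqrt (jap k))) * ‖cf W k q‖ₑ) * mono y q := by ring
    _ ≤ (ENNReal.ofReal B * ‖cf V k q‖ₑ * ENNReal.ofReal (Real.exp (σ * wt q))) * mono y q := by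
      gcongr
    _ = _ := by ring

/-- The prefactor `r⁻¹` works against monotonicity; absence of constant terms compensates it, since
`c ^ deg ≤ c` for `c = r'/r ≤ 1` and degree at least one. -/
theorem majNorm_radius_mono {s r r' : ℝ} (hr' : 0 < r') (hrr : r' ≤ r) {V : FormalVF}
    (h0 : ∀ k, cf V k 0 = 0) : majNorm s r' V ≤ majNorm s r V := by
  have hr : 0 < r := hr'.trans_le hrr
  refine majNorm_le hr' fun y hy => ?_
  set c := ENNReal.ofReal (r' / r) with hc
  set z : Idx → ℝ≥0∞ := fun k => ENNReal.ofReal (r / r') * y k with hz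
  have hyz : y = fun k => c * z k := by
    funext k
    rw [hz, hc]
    simp only
    rw [← mul_assoc, ← ENNReal.ofReal_mul (by positivity), div_mul_div_cancel₀ hr.ne',
      div_self hr'.ne', ENNReal.ofReal_one, one_mul]
  have hzn : weightedNorm s z < ENNReal.ofReal r := by
    rw [hz, weightedNorm_const_mul]
    have : ENNReal.ofReal r = ENNReal.ofReal (r / r') * ENNReal.ofReal r' := by
      rw [← ENNReal.ofReal_mul (by positivity), div_mul_cancel₀ _ hr'.ne']
    rw [this]
    exact ENNReal.mul_lt_mul_right (by rw [Ne, ENNReal.ofReal_eq_zero, not_le]; positivity)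
      ENNReal.ofReal_ne_top hy
  have hc1 : c ≤ 1 := by
    rw [hc, ← ENNReal.ofReal_one]
    exact ENNReal.ofReal_le_ofReal ((div_le_one hr).mpr hrr)
  calc weightedNorm s (Maj V y) ≤ weightedNorm s (fun k => c * Maj V z k) := by
        refine weightedNorm_mono s fun k => ?_
        unfold Maj
        rw [← ENNReal.tsum_mul_left]
        refine ENNReal.tsum_le_tsum fun q => ?_
        by_cases hq : q = 0
        · simp [hq, h0]
        have hd : 1 ≤ q.degree := degree_pos_of_ne_zero hq
        rw [hyz, mono_mul (fun _ => c), mono_const, mul_left_comm]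
        gcongr
        exact pow_le_of_le_one zero_le hc1 (by omega)
    _ = c * weightedNorm s (Maj V z) := weightedNorm_const_mul _ _ _
    _ ≤ c * (ENNReal.ofReal r * majNorm s r V) := by
        gcongr
        exact Maj_le_of_gNorm_lt hr V hzn
    _ = _ := by
        rw [← mul_assoc, hc, ← ENNReal.ofReal_mul (by positivity), div_mul_cancel₀ _ hr.ne']

/-! ### The Cauchy estimate for `X[Z]` -/

/-- The left side consists of the terms of order zero and one in `v` of the expansion of `(y +
v)^q`, all of whose terms are nonnegative. The truncated subtraction is harmless because of the
factor `q k`. -/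
theorem mono_add_sum_le (y v : Idx → ℝ≥0∞) (q : Idx →₀ ℕ) :
    mono y q + ∑' k, v k * (q k * mono y (q - Finsupp.single k 1)) ≤
      mono (fun k => y k + v k) q := by
  induction hn : q.degree generalizing q with
  | zero =>
    rw [(Finsupp.degree_eq_zero_iff q).mp hn]
    simp [mono]
  | succ n ih =>
    obtain ⟨i, hi⟩ : ∃ i, q i ≠ 0 := by
      by_contra! hc
      have : q = 0 := Finsupp.ext hc
      simp [this] at hn
    obtain ⟨p, rfl⟩ : ∃ b, q = b + Finsupp.single i 1 :=
      ⟨q - Finsupp.single i 1, (tsub_add_cancel_of_le (by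
        rw [Finsupp.single_le_iff]; omega)).symm⟩
    have hp := ih p (by simpa using hn)
    have hk : ∀ k, v k * ((((p + Finsupp.single i 1 : Idx →₀ ℕ) k : ℕ) : ℝ≥0∞) *
        mono y (p + Finsupp.single i 1 - Finsupp.single k 1)) =
        y i * (v k * (p k * mono y (p - Finsupp.single k 1))) +
          if k = i then v i * mono y p else 0 := by
      intro k
      have h1 : (p k : ℝ≥0∞) * mono y (p + Finsupp.single i 1 - Finsupp.single k 1) =
          y i * (p k * mono y (p - Finsupp.single k 1)) := by
        by_cases hpk : p k = 0
        · simp [hpk]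
        · rw [tsub_add_eq_add_tsub (by rw [Finsupp.single_le_iff]; omega) |>.symm, mono_add,
            mono_single]
          ring
      by_cases hki : k = i
      · subst hki
        rw [if_pos rfl, Finsupp.add_apply, Finsupp.single_eq_same, Nat.cast_add, add_mul, mul_add,
          h1, add_tsub_cancel_right]
        push_cast
        ring
      · rw [if_neg hki, Finsupp.add_apply, Finsupp.single_eq_of_ne hki, add_zero, h1]
        ring
    simp_rw [hk]
    rw [ENNReal.tsum_add, ENNReal.tsum_mul_left, tsum_ite_eq, mono_add, mono_add, mono_single,
      mono_single, mul_add]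
    calc _ = (mono y p + ∑' k, v k * (p k * mono y (p - Finsupp.single k 1))) * y i +
          mono y p * v i := by ring
      _ ≤ _ := by
        gcongr
        exact le_trans le_self_add hp

/-- The bound is the derivative of the majorant of `Z` in the direction of the majorant of `X`. -/
theorem Maj_applyVF_le (X Z : FormalVF) (y : Idx → ℝ≥0∞) (j : Idx) :
    Maj (fun j => applyVF X (Z j)) y j ≤
      ∑' q, ‖cf Z j q‖ₑ * ∑' k, Maj X y k * (q k * mono y (q - Finsupp.single k 1)) := by
  classical
  set h : Idx → (Idx →₀ ℕ) → ℝ≥0∞ := fun k q =>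
    ‖cf Z j q‖ₑ * (q k * mono y (q - Finsupp.single k 1)) with hh
  set g : Idx → (Idx →₀ ℕ) → (Idx →₀ ℕ) → ℝ≥0∞ := fun k a b =>
    ‖cf X k a‖ₑ * mono y a * h k (b + Finsupp.single k 1) with hg
  have h1 : ∀ q, ‖cf (fun j => applyVF X (Z j)) j q‖ₑ * mono y q ≤
      ∑' k, ∑ a ∈ Finset.HasAntidiagonal.antidiagonal q, g k a.1 a.2 := by
    intro q
    rw [cf, coeff_applyVF]
    refine le_trans (mul_le_mul_left enorm_tsum_le_tsum_enorm _) ?_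
    rw [← ENNReal.tsum_mul_right]
    refine ENNReal.tsum_le_tsum fun k => ?_
    rw [MvPowerSeries.coeff_mul]
    refine le_trans (mul_le_mul_left (enorm_sum_le _ _) _) ?_
    rw [Finset.sum_mul]
    refine Finset.sum_le_sum fun a ha => le_of_eq ?_
    rw [← Finset.HasAntidiagonal.mem_antidiagonal.mp ha, MvPowerSeries.coeff_pderiv, mono_add, hg,
      hh]
    simp only [add_tsub_cancel_right, enorm_mul, cf, Finsupp.add_apply, Finsupp.single_eq_same]
    have h2 : ‖((a.2 k : ℂ) + 1)‖ₑ = ((a.2 k + 1 : ℕ) : ℝ≥0∞) := by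
      have : ((a.2 k : ℂ) + 1) = ((a.2 k + 1 : ℕ) : ℂ) := by push_cast; rfl
      rw [this, ← ofReal_norm, Complex.norm_natCast, ENNReal.ofReal_natCast]
    rw [h2]
    ring
  calc Maj (fun j => applyVF X (Z j)) y j
      ≤ ∑' q, ∑' k, ∑ a ∈ Finset.HasAntidiagonal.antidiagonal q, g k a.1 a.2 :=
        ENNReal.tsum_le_tsum h1
    _ = ∑' k, ∑' q, ∑ a ∈ Finset.HasAntidiagonal.antidiagonal q, g k a.1 a.2 := ENNReal.tsum_comm
    _ = ∑' k, ∑' (a : Idx →₀ ℕ) (b : Idx →₀ ℕ), g k a b := by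
        refine tsum_congr fun k => ?_
        rw [← ENNReal.tsum_prod,
          ← Finset.HasAntidiagonal.sigmaAntidiagonalEquivProd.tsum_eq, ENNReal.tsum_sigma']
        refine tsum_congr fun q => ?_
        rw [← Finset.tsum_subtype (Finset.HasAntidiagonal.antidiagonal q)
          (fun a : (Idx →₀ ℕ) × (Idx →₀ ℕ) => g k a.1 a.2)]
        rfl
    _ = ∑' k, Maj X y k * ∑' b, h k (b + Finsupp.single k 1) := by
        refine tsum_congr fun k => ?_
        simp only [hg, ENNReal.tsum_mul_left, ENNReal.tsum_mul_right]
        rfl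
    _ ≤ ∑' k, Maj X y k * ∑' q, h k q := by
        refine ENNReal.tsum_le_tsum fun k => ?_
        exact mul_le_mul_right (ENNReal.tsum_comp_le_tsum_of_injective
          (add_left_injective (Finsupp.single k 1)) (h k)) _
    _ = _ := by
        simp only [← ENNReal.tsum_mul_left]
        rw [ENNReal.tsum_comm]
        refine tsum_congr fun q => tsum_congr fun k => ?_
        rw [hh]
        ring

/-- A Cauchy estimate without contour integrals: for series with nonnegative coefficients, `t` times
a directional derivative is at most the value at the displaced point. -/
theorem mul_Maj_applyVF_le (X Z : FormalVF) (y : Idx → ℝ≥0∞) (t : ℝ≥0∞) (j : Idx) :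
    t * Maj (fun j => applyVF X (Z j)) y j ≤ Maj Z (fun k => y k + t * Maj X y k) j := by
  refine le_trans (mul_le_mul_right (Maj_applyVF_le X Z y j) t) ?_
  rw [← ENNReal.tsum_mul_left]
  refine ENNReal.tsum_le_tsum fun q => ?_
  rw [mul_left_comm]
  gcongr
  refine le_trans ?_ (mono_add_sum_le y (fun k => t * Maj X y k) q)
  refine le_trans (le_of_eq ?_) le_add_self
  rw [← ENNReal.tsum_mul_left]
  exact tsum_congr fun k => (mul_assoc _ _ _).symm

/-- The Cauchy estimate: `X[Z]` is bounded with loss of `ρ` in the radius. -/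
theorem majNorm_applyVF_le {s r ρ : ℝ} (hρ : 0 < ρ) (hρr : ρ < r) {X Z : FormalVF}
    (hX : majNorm s (r - ρ) X < ⊤) :
    majNorm s (r - ρ) (fun j => applyVF X (Z j)) ≤
      ENNReal.ofReal (r / ρ) * majNorm s (r - ρ) X * majNorm s r Z := by
  have hr : 0 < r := hρ.trans hρr
  have hr' : 0 < r - ρ := sub_pos.mpr hρr
  refine majNorm_le hr' fun y hy => ?_
  have hXy := Maj_le_of_gNorm_lt hr' X hy
  set N := majNorm s (r - ρ) X with hN
  -- The displacement `t` below divides by the norm of `X`; when that norm is zero, the majorant of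
  -- `X` vanishes at `y`.
  by_cases hN0 : N = 0
  · rw [hN0, mul_zero, nonpos_iff_eq_zero] at hXy
    have h0 : ∀ k, Maj X y k = 0 := eq_zero_of_weightedNorm_eq_zero hXy
    have h1 : weightedNorm s (Maj (fun j => applyVF X (Z j)) y) ≤
        weightedNorm s (fun k => 0 * Maj (fun j => applyVF X (Z j)) y k) := by
      refine weightedNorm_mono s fun j => le_trans (Maj_applyVF_le X Z y j) ?_
      simp [h0]
    rw [weightedNorm_const_mul, zero_mul] at h1
    exact h1.trans zero_le
  set n := N.toReal with hn
  have hNn : N = ENNReal.ofReal n := (ENNReal.ofReal_toReal hX.ne).symm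
  have hn0 : 0 < n := ENNReal.toReal_pos hN0 hX.ne
  -- Chosen so that the displacement `t * Maj X y` has norm at most `ρ`, keeping the displaced point
  -- in the ball of radius `r`.
  set t := ρ / ((r - ρ) * n) with ht
  have ht0 : 0 < t := by positivity
  have hz : weightedNorm s (fun k => y k + ENNReal.ofReal t * Maj X y k) < ENNReal.ofReal r := by
    refine lt_of_le_of_lt (weightedNorm_add_le s _ _) ?_
    rw [weightedNorm_const_mul]
    have h2 : ENNReal.ofReal t * weightedNorm s (Maj X y) ≤ ENNReal.ofReal ρ := by
      refine le_trans (mul_le_mul_right hXy _) (le_of_eq ?_)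
      rw [hNn, ← ENNReal.ofReal_mul hr'.le, ← ENNReal.ofReal_mul ht0.le, ht,
        div_mul_cancel₀ _ (by positivity)]
    have h3 : ENNReal.ofReal r = ENNReal.ofReal (r - ρ) + ENNReal.ofReal ρ := by
      rw [← ENNReal.ofReal_add hr'.le hρ.le, sub_add_cancel]
    rw [h3]
    exact ENNReal.add_lt_add_of_lt_of_le (ne_top_of_le_ne_top ENNReal.ofReal_ne_top h2) hy h2
  have h4 : ENNReal.ofReal t * weightedNorm s (Maj (fun j => applyVF X (Z j)) y) ≤
      ENNReal.ofReal r * majNorm s r Z := by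
    rw [← weightedNorm_const_mul]
    exact (weightedNorm_mono s fun j => mul_Maj_applyVF_le X Z y _ j).trans
      (Maj_le_of_gNorm_lt hr Z hz)
  calc weightedNorm s (Maj (fun j => applyVF X (Z j)) y)
      = ENNReal.ofReal t⁻¹ *
        (ENNReal.ofReal t * weightedNorm s (Maj (fun j => applyVF X (Z j)) y)) := by
        rw [← mul_assoc, ← ENNReal.ofReal_mul (by positivity), inv_mul_cancel₀ ht0.ne',
          ENNReal.ofReal_one, one_mul]
    _ ≤ ENNReal.ofReal t⁻¹ * (ENNReal.ofReal r * majNorm s r Z) := by gcongr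
    _ = _ := by
        rw [hNn, ← mul_assoc, ← mul_assoc, ← mul_assoc, ← ENNReal.ofReal_mul (by positivity),
          ← ENNReal.ofReal_mul (by positivity), ← ENNReal.ofReal_mul (by positivity)]
        congr 2
        rw [ht]
        field_simp

/-! ### Elementary inequalities -/

/-- Used with `w = t^{1/7}`, so that `w^28 = t^4`. -/
theorem log_one_add_pow_le {w : ℝ} (hw : 1 ≤ w) : Real.log (1 + w ^ 28) ≤ 28 * w ^ 2 := by
  have h1 : 1 ≤ w ^ 28 := one_le_pow₀ hw
  calc Real.log (1 + w ^ 28) ≤ Real.log (2 * w ^ 28) :=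
        Real.log_le_log (by positivity) (by linarith)
    _ = Real.log 2 + 28 * Real.log w := by
        rw [Real.log_mul (by norm_num) (by positivity), Real.log_pow]
        norm_num
    _ ≤ 1 + 28 * (w - 1) := by
        have h2 := Real.log_le_sub_one_of_pos (show (0 : ℝ) < 2 by norm_num)
        have h3 := Real.log_le_sub_one_of_pos (show (0 : ℝ) < w by linarith)
        linarith
    _ ≤ 28 * w ^ 2 := by nlinarith

/-- The constant in `mul_log_one_add_pow_le`. -/
def logConst (θ : ℝ) : ℝ := 28 * θ * (112 * θ) ^ 6

/-- With `t = w^7` the left side is at most `28θw²`. This is below `σt/4` as soon as `112θ ≤ σw⁵`;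
otherwise the sixth power of the reverse inequality bounds `σ⁶w³⁰ = σ⁶ w² t⁴`. The exponent `30 = 2
+ 28` is the source of `σ⁻⁶`, and the decay `t⁻⁴` is what makes the error summable over indices. -/
theorem mul_log_one_add_pow_le {θ σ t : ℝ} (hθ : 0 < θ) (hσ : 0 < σ) (ht : 1 ≤ t) :
    θ * Real.log (1 + t ^ 4) ≤ σ / 4 * t + logConst θ / σ ^ 6 * (t ^ 4)⁻¹ := by
  obtain ⟨w, hw, rfl⟩ : ∃ w : ℝ, 1 ≤ w ∧ w ^ 7 = t := by
    refine ⟨t ^ ((7 : ℝ)⁻¹), Real.one_le_rpow ht (by norm_num), ?_⟩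
    have := Real.rpow_inv_natCast_pow (n := 7) (show 0 ≤ t by linarith) (by norm_num)
    exact_mod_cast this
  have hw0 : 0 < w := by linarith
  have h1 : θ * Real.log (1 + (w ^ 7) ^ 4) ≤ 28 * θ * w ^ 2 := by
    have := log_one_add_pow_le hw
    rw [← pow_mul]
    nlinarith
  by_cases hc : 112 * θ ≤ σ * w ^ 5
  · have h2 : 28 * θ * w ^ 2 ≤ σ / 4 * w ^ 7 := by
      have : 28 * θ * w ^ 2 = (112 * θ) * w ^ 2 / 4 := by ring
      rw [this]
      have : σ / 4 * w ^ 7 = (σ * w ^ 5) * w ^ 2 / 4 := by ring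
      rw [this]
      gcongr
    have : 0 ≤ logConst θ / σ ^ 6 * ((w ^ 7) ^ 4)⁻¹ := by
      unfold logConst
      positivity
    linarith
  · push Not at hc
    have h3 : (σ * w ^ 5) ^ 6 ≤ (112 * θ) ^ 6 := by gcongr
    have h2 : 28 * θ * w ^ 2 ≤ logConst θ / σ ^ 6 * ((w ^ 7) ^ 4)⁻¹ := by
      rw [← div_eq_mul_inv, div_div, le_div_iff₀ (by positivity), logConst]
      calc 28 * θ * w ^ 2 * (σ ^ 6 * (w ^ 7) ^ 4) = 28 * θ * (σ * w ^ 5) ^ 6 := by ring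
        _ ≤ _ := by gcongr
    have : 0 ≤ σ / 4 * w ^ 7 := by positivity
    linarith

/-- The previous inequality at `t = n√j`, where `t⁴ = n⁴j²` dominates `n²j²`. -/
theorem mul_log_one_add_sq_le {θ σ n j : ℝ} (hθ : 0 < θ) (hσ : 0 < σ) (hn : 1 ≤ n) (hj : 1 ≤ j) :
    θ * Real.log (1 + n ^ 2 * j ^ 2) ≤
      σ / 4 * (n * Real.sqrt j) + logConst θ / σ ^ 6 * (j ^ 2)⁻¹ := by
  have hs : 1 ≤ Real.sqrt j := Real.one_le_sqrt.mpr hj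
  have ht : 1 ≤ n * Real.sqrt j := one_le_mul_of_one_le_of_one_le hn hs
  have h4 : (n * Real.sqrt j) ^ 4 = n ^ 4 * j ^ 2 := by
    have : Real.sqrt j ^ 4 = j ^ 2 := by
      rw [show Real.sqrt j ^ 4 = (Real.sqrt j ^ 2) ^ 2 by ring, Real.sq_sqrt (by linarith)]
    rw [mul_pow, this]
  have h := mul_log_one_add_pow_le hθ hσ ht
  rw [h4] at h
  have hn1 : n ^ 2 ≤ n ^ 4 := pow_le_pow_right₀ hn (by norm_num)
  have h1 : Real.log (1 + n ^ 2 * j ^ 2) ≤ Real.log (1 + n ^ 4 * j ^ 2) :=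
    Real.log_le_log (by positivity) (by gcongr)
  have h2 : (n ^ 4 * j ^ 2)⁻¹ ≤ (j ^ 2)⁻¹ := by
    have : 1 ≤ n ^ 4 := one_le_pow₀ hn
    gcongr
    nlinarith [sq_nonneg j]
  have h3 : 0 ≤ logConst θ / σ ^ 6 := by
    unfold logConst
    positivity
  calc _ ≤ θ * Real.log (1 + n ^ 4 * j ^ 2) := by gcongr
    _ ≤ _ := h
    _ ≤ _ := by gcongr

theorem sqrt_add_le {A B : ℝ} (hA : 0 < A) (hB : 0 ≤ B) :
    Real.sqrt (A + B) ≤ Real.sqrt A + B / (2 * Real.sqrt A) := by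
  have hs : 0 < Real.sqrt A := Real.sqrt_pos.mpr hA
  refine Real.sqrt_le_iff.mpr ⟨by positivity, ?_⟩
  have h1 := Real.sq_sqrt hA.le
  have h2 : (Real.sqrt A + B / (2 * Real.sqrt A)) ^ 2 =
      Real.sqrt A ^ 2 + B + (B / (2 * Real.sqrt A)) ^ 2 := by
    field_simp
    ring
  rw [h2, h1]
  have : 0 ≤ (B / (2 * Real.sqrt A)) ^ 2 := by positivity
  linarith

theorem summable_inv_jap_sq : Summable fun k : Idx => (jap k ^ 2)⁻¹ := by
  have h1 : Summable fun n : ℤ => ((max |(n : ℝ)| 1) ^ 2)⁻¹ := by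
    refine Summable.of_nonneg_of_le (fun n => by positivity) (fun n => ?_)
      ((Real.summable_one_div_int_pow (p := 2).mpr (by norm_num)).add
        (hasSum_ite_eq (0 : ℤ) (1 : ℝ)).summable)
    by_cases hn : n = 0
    · simp [hn]
    · have h2 : (1 : ℝ) ≤ |(n : ℝ)| := by exact_mod_cast Int.one_le_abs hn
      rw [max_eq_left h2, sq_abs]
      simp [hn]
  have h2 := Summable.mul_of_nonneg h1 (Summable.of_finite (f := fun _ : ℤˣ => (1 : ℝ)))
    (fun n => by positivity) (fun _ => zero_le_one)
  simpa [jap] using h2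

/-! ### Weights and momentum -/

theorem abs_mom (k : Idx) : |mom k| = |k.1| := by
  rw [mom, abs_mul]
  rcases Int.units_eq_one_or k.2 with h | h <;> simp [h]

theorem abs_mom_le_jap (k : Idx) : |(mom k : ℝ)| ≤ jap k := by
  have h : |(mom k : ℝ)| = |(k.1 : ℝ)| := by exact_mod_cast congrArg (Int.cast (R := ℝ)) (abs_mom k)
  rw [h]
  exact le_max_left _ _

theorem sqrt_jap_le_wt {q : Idx →₀ ℕ} {i : Idx} (hi : i ∈ q.support) :
    Real.sqrt (jap i) ≤ wt q := by
  have h1 : (1 : ℝ) ≤ q i := by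
    have := Finsupp.mem_support_iff.mp hi
    exact_mod_cast Nat.one_le_iff_ne_zero.mpr this
  have h2 : (q i : ℝ) * Real.sqrt (jap i) ≤ wt q :=
    Finset.single_le_sum (f := fun i => (q i : ℝ) * Real.sqrt (jap i))
      (fun i _ => by positivity) hi
  nlinarith [Real.sqrt_nonneg (jap i)]

/-- Each `√⟨i⟩` with `i` in the support is at most `wt q`; all but one of the `2(m + 1)` such
factors are replaced by `wt q`. -/
theorem sum_jap_pow_le (q : Idx →₀ ℕ) (m : ℕ) :
    ∑ i ∈ q.support, (q i : ℝ) * jap i ^ (m + 1) ≤ wt q ^ (2 * (m + 1)) := by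
  have h : ∀ i, jap i ^ (m + 1) = Real.sqrt (jap i) * Real.sqrt (jap i) ^ (2 * m + 1) := by
    intro i
    rw [← pow_succ', show 2 * m + 1 + 1 = 2 * (m + 1) by ring, pow_mul,
      Real.sq_sqrt (jap_pos i).le]
  calc ∑ i ∈ q.support, (q i : ℝ) * jap i ^ (m + 1)
      ≤ ∑ i ∈ q.support, (q i * Real.sqrt (jap i)) * wt q ^ (2 * m + 1) := by
        refine Finset.sum_le_sum fun i hi => ?_
        rw [h, ← mul_assoc]
        gcongr
        exact sqrt_jap_le_wt hi
    _ = wt q ^ (2 * (m + 1)) := by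
        rw [← Finset.sum_mul, show 2 * (m + 1) = 2 * m + 1 + 1 by ring,
          pow_succ' _ (2 * m + 1)]
        rfl

theorem abs_linearCombination_mom_le (q : Idx →₀ ℕ) :
    |((Finsupp.linearCombination ℕ mom q : ℤ) : ℝ)| ≤ ∑ i ∈ q.support, (q i : ℝ) * jap i := by
  rw [Finsupp.linearCombination_apply, Finsupp.sum, Int.cast_sum]
  refine (Finset.abs_sum_le_sum_abs _ _).trans (Finset.sum_le_sum fun i _ => ?_)
  rw [nsmul_eq_mul, Int.cast_mul, abs_mul]
  push_cast
  rw [Nat.abs_cast]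
  gcongr
  exact abs_mom_le_jap i

/-- The weight of the target is dominated by the one of the exponent, with a gain of half of the
weight of all but the largest factor. -/
theorem half_wt_le {q : Idx →₀ ℕ} {a k : Idx} (ha : ∀ i ∈ q.support, jap i ≤ jap a)
    (hmom : Finsupp.linearCombination ℕ mom q + mom a = mom k) :
    wt q / 2 ≤ wt (q + Finsupp.single a 1) - Real.sqrt (jap k) := by
  have hs : 0 < Real.sqrt (jap a) := Real.sqrt_pos.mpr (jap_pos a)
  set B := ∑ i ∈ q.support, (q i : ℝ) * jap i with hB
  have hB0 : 0 ≤ B := Finset.sum_nonneg fun i _ => by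
    have := jap_pos i
    positivity
  have hk : jap k ≤ jap a + B := by
    refine max_le ?_ (by linarith [jap_one_le a])
    have h1 : |(k.1 : ℝ)| = |(mom k : ℝ)| := by
      exact_mod_cast congrArg (Int.cast (R := ℝ)) (abs_mom k).symm
    rw [h1, ← hmom]
    push_cast
    refine (abs_add_le _ _).trans ?_
    linarith [abs_linearCombination_mom_le q, abs_mom_le_jap a]
  -- Maximality of `a` gives `⟨i⟩ / √⟨a⟩ ≤ √⟨i⟩`. Concavity of the square root then supplies the
  -- factor `1/2` that leaves half the weight as gain.
  have hBw : B / Real.sqrt (jap a) ≤ wt q := by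
    rw [hB, Finset.sum_div, wt]
    refine Finset.sum_le_sum fun i hi => ?_
    rw [mul_div_assoc]
    refine mul_le_mul_of_nonneg_left ?_ (Nat.cast_nonneg _)
    rw [div_le_iff₀ hs]
    calc jap i = Real.sqrt (jap i) * Real.sqrt (jap i) := (Real.mul_self_sqrt (jap_pos i).le).symm
      _ ≤ _ := by
        gcongr
        exact ha i hi
  have h2 : Real.sqrt (jap k) ≤ Real.sqrt (jap a) + wt q / 2 := by
    calc Real.sqrt (jap k) ≤ Real.sqrt (jap a + B) := Real.sqrt_le_sqrt hk
      _ ≤ Real.sqrt (jap a) + B / (2 * Real.sqrt (jap a)) := sqrt_add_le (jap_pos a) hB0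
      _ = Real.sqrt (jap a) + B / Real.sqrt (jap a) / 2 := by
        rw [div_div, mul_comm (Real.sqrt _) 2]
      _ ≤ _ := by gcongr
  rw [wt_add, wt_single]
  linarith

theorem exists_eq_add_single_max {q : Idx →₀ ℕ} (hq : q ≠ 0) :
    ∃ a p, q = p + Finsupp.single a 1 ∧ ∀ i ∈ p.support, jap i ≤ jap a := by
  obtain ⟨a, ha, hmax⟩ := Finset.exists_max_image q.support jap
    (Finsupp.support_nonempty_iff.mpr hq)
  obtain ⟨p, rfl⟩ : ∃ b, q = b + Finsupp.single a 1 :=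
    ⟨q - Finsupp.single a 1, (tsub_add_cancel_of_le (by
      rw [Finsupp.single_le_iff]
      exact Nat.one_le_iff_ne_zero.mpr (Finsupp.mem_support_iff.mp ha))).symm⟩
  refine ⟨a, p, rfl, fun i hi => hmax i ?_⟩
  rw [Finsupp.mem_support_iff] at hi ⊢
  rw [Finsupp.add_apply]
  omega

theorem sqrt_jap_le_wt_of_mom {q : Idx →₀ ℕ} {k : Idx} (hq : q ≠ 0)
    (hmom : Finsupp.linearCombination ℕ mom q = mom k) : Real.sqrt (jap k) ≤ wt q := by
  obtain ⟨a, p, rfl, hmax⟩ := exists_eq_add_single_max hq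
  have := half_wt_le hmax (k := k) (by simpa using hmom)
  linarith [wt_nonneg p]

/-! ### Products `∏ (1 + p_i² ⟨i⟩²)` -/

/-- The product `∏ (1 + p_i² ⟨i⟩²)`. -/
def japProd (p : Idx →₀ ℤ) : ℝ := p.prod fun i n => 1 + (n : ℝ) ^ 2 * jap i ^ 2

theorem one_le_japProd_factor (i : Idx) (n : ℤ) : 1 ≤ 1 + (n : ℝ) ^ 2 * jap i ^ 2 :=
  le_add_of_nonneg_right (by positivity)

theorem one_le_japProd (p : Idx →₀ ℤ) : 1 ≤ japProd p :=
  Finset.one_le_prod fun i _ => one_le_japProd_factor i _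

theorem japProd_add_single_le (p : Idx →₀ ℤ) (i : Idx) {e : ℤ} (he : e ^ 2 = 1) :
    japProd (p + Finsupp.single i e) ≤ 4 * jap i ^ 2 * japProd p := by
  classical
  set S := insert i p.support with hS
  have h1 : japProd p = ∏ k ∈ S, (1 + (p k : ℝ) ^ 2 * jap k ^ 2) :=
    Finsupp.prod_of_support_subset _ (Finset.subset_insert _ _) _ (by simp)
  have h2 : japProd (p + Finsupp.single i e) =
      ∏ k ∈ S, (1 + (((p + Finsupp.single i e : Idx →₀ ℤ) k : ℤ) : ℝ) ^ 2 * jap k ^ 2) := by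
    refine Finsupp.prod_of_support_subset _ ?_ _ (by simp)
    intro k hk
    by_cases hki : k = i
    · exact hki ▸ Finset.mem_insert_self _ _
    · refine Finset.mem_insert_of_mem ?_
      simpa [hki] using hk
  have h3 : 4 * jap i ^ 2 = ∏ k ∈ S, if k = i then 4 * jap i ^ 2 else 1 := by
    rw [Finset.prod_ite_eq', if_pos (Finset.mem_insert_self _ _)]
  rw [h1, h2, h3, ← Finset.prod_mul_distrib]
  refine Finset.prod_le_prod (fun k _ => by positivity) fun k _ => ?_
  by_cases hki : k = i
  · subst hki
    rw [if_pos rfl, Finsupp.add_apply, Finsupp.single_eq_same]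
    push_cast
    have he' : (e : ℝ) ^ 2 = 1 := by exact_mod_cast he
    have hj : 1 ≤ jap k ^ 2 := one_le_pow₀ (jap_one_le k)
    have h4 : ((p k : ℝ) + e) ^ 2 ≤ 2 * (p k : ℝ) ^ 2 + 2 := by nlinarith [sq_nonneg ((p k : ℝ) - e)]
    have h5 : ((p k : ℝ) + e) ^ 2 * jap k ^ 2 ≤ (2 * (p k : ℝ) ^ 2 + 2) * jap k ^ 2 := by gcongr
    have h6 : (p k : ℝ) ^ 2 * jap k ^ 2 * 1 ≤ (p k : ℝ) ^ 2 * jap k ^ 2 * jap k ^ 2 := by gcongr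
    nlinarith
  · rw [if_neg hki, Finsupp.add_apply, Finsupp.single_eq_of_ne hki]
    simp

/-- The logarithm splits over indices: the main terms add up to the weight, and the errors stay
below the convergent sum of `⟨k⟩⁻²`, whatever the size of the support. -/
theorem japProd_rpow_le {θ σ : ℝ} (hθ : 0 < θ) (hσ : 0 < σ) (q : Idx →₀ ℕ) :
    japProd (toInt q) ^ θ ≤
      Real.exp (σ / 4 * wt q + (logConst θ * ∑' k, (jap k ^ 2)⁻¹) / σ ^ 6) := by
  have h1 : japProd (toInt q) = ∏ i ∈ q.support, (1 + (q i : ℝ) ^ 2 * jap i ^ 2) := by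
    rw [japProd, toInt, Finsupp.prod_mapRange_index (by simp), Finsupp.prod]
    simp
  have h0 : 0 < japProd (toInt q) := zero_lt_one.trans_le (one_le_japProd _)
  rw [Real.rpow_def_of_pos h0, h1, Real.log_prod (fun i _ => by positivity), Finset.sum_mul]
  refine Real.exp_le_exp.mpr ?_
  have hc : 0 ≤ logConst θ / σ ^ 6 := by
    unfold logConst
    positivity
  calc ∑ i ∈ q.support, Real.log (1 + (q i : ℝ) ^ 2 * jap i ^ 2) * θ
      ≤ ∑ i ∈ q.support, (σ / 4 * (q i * Real.sqrt (jap i)) +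
          logConst θ / σ ^ 6 * (jap i ^ 2)⁻¹) := by
        refine Finset.sum_le_sum fun i hi => ?_
        rw [mul_comm]
        refine mul_log_one_add_sq_le hθ hσ ?_ (jap_one_le i)
        exact_mod_cast Nat.one_le_iff_ne_zero.mpr (Finsupp.mem_support_iff.mp hi)
    _ = σ / 4 * wt q + logConst θ / σ ^ 6 * ∑ i ∈ q.support, (jap i ^ 2)⁻¹ := by
        rw [Finset.sum_add_distrib, ← Finset.mul_sum, ← Finset.mul_sum]
        rfl
    _ ≤ σ / 4 * wt q + logConst θ / σ ^ 6 * ∑' k, (jap k ^ 2)⁻¹ := by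
        gcongr
        exact summable_inv_jap_sq.sum_le_tsum _ fun i _ => by positivity
    _ = _ := by ring

/-! ### Small divisors -/

/-- `τ` may be negative; as the product is at least `1`, the exponent can be raised to any `θ ≥ τ`.
-/
theorem DiophantineMod.le_mul_japProd {lam : Idx → ℂ} {γ τ θ : ℝ} (h : DiophantineMod lam γ τ)
    (hγ : 0 < γ) (hτ : τ ≤ θ) {p : Idx →₀ ℤ} {k : Idx}
    (hlam : Finsupp.linearCombination ℤ lam p ≠ 0) (hmom : Finsupp.linearCombination ℤ mom p = 0)
    (hk : 0 ≤ p + Finsupp.single k 1) :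
    ‖Finsupp.linearCombination ℤ lam p‖⁻¹ ≤ γ⁻¹ * japProd p ^ θ := by
  have h1 : p ∉ Delta lam := fun hp => by
    obtain ⟨j, hj⟩ := Set.mem_iUnion.mp hp
    exact hlam hj.1
  have h2 := h p h1 hmom ⟨k, hk⟩
  have h3 : p.prod (fun i n => 1 / (1 + (n : ℝ) ^ 2 * jap i ^ 2) ^ τ) = (japProd p ^ τ)⁻¹ := by
    rw [japProd, Finsupp.prod, Finsupp.prod, ← Real.finsetProd_rpow _ _ (fun i _ => by positivity),
      ← Finset.prod_inv_distrib]
    simp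
  have h0 : 0 < japProd p := zero_lt_one.trans_le (one_le_japProd _)
  rw [h3] at h2
  have h4 : japProd p ^ τ ≤ japProd p ^ θ := Real.rpow_le_rpow_of_exponent_le (one_le_japProd _) hτ
  calc _ ≤ (γ * (japProd p ^ τ)⁻¹)⁻¹ := by gcongr
    _ = γ⁻¹ * japProd p ^ τ := by rw [mul_inv, inv_inv]
    _ ≤ _ := by gcongr

theorem norm_le_of_superlinear {C : ℝ} {lam : Idx → ℂ} (h : Superlinear C lam) (k : Idx) :
    ‖lam k‖ ≤ 3 / 2 * jap k ^ 2 := by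
  obtain ⟨φ, hφ, -⟩ := h
  have h1 : ‖(jap k : ℂ) ^ 2 * Complex.exp (Complex.I * φ k)‖ = jap k ^ 2 := by
    rw [norm_mul, mul_comm Complex.I, Complex.norm_exp_ofReal_mul_I, mul_one, norm_pow,
      Complex.norm_real, Real.norm_of_nonneg (jap_pos k).le]
  have h2 := norm_le_norm_add_norm_sub' (lam k)
    ((jap k : ℂ) ^ 2 * Complex.exp (Complex.I * φ k))
  have h3 : 1 ≤ jap k ^ 2 := one_le_pow₀ (jap_one_le k)
  linarith [hφ k]

theorem norm_linearCombination_le {C : ℝ} {lam : Idx → ℂ} (h : Superlinear C lam)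
    (q : Idx →₀ ℕ) : ‖Finsupp.linearCombination ℕ lam q‖ ≤ 3 / 2 * wt q ^ 4 := by
  rw [Finsupp.linearCombination_apply, Finsupp.sum]
  calc _ ≤ ∑ i ∈ q.support, ‖q i • lam i‖ := norm_sum_le _ _
    _ ≤ ∑ i ∈ q.support, 3 / 2 * ((q i : ℝ) * jap i ^ 2) := by
        refine Finset.sum_le_sum fun i _ => ?_
        rw [nsmul_eq_mul, norm_mul, Complex.norm_natCast, mul_left_comm]
        gcongr
        exact norm_le_of_superlinear h i
    _ ≤ _ := by
        rw [← Finset.mul_sum]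
        gcongr
        exact sum_jap_pow_le q 1

theorem jap_eq_intCast (k : Idx) : jap k = ((max |k.1| 1 : ℤ) : ℝ) := by
  simp [jap]

/-- The two largest indices are controlled by the others, unless they are resonant. -/
theorem jap_le_of_superlinear {C : ℝ} (hC : 0 < C) {lam : Idx → ℂ} (h : Superlinear C lam)
    {a k : Idx} {E : ℝ} (hE : 2 ≤ E) (hlam : ‖lam a - lam k‖ ≤ E - 1)
    (hmom : |(mom a : ℝ) - mom k| ≤ E) (hne : ¬ (lam a = lam k ∧ mom a = mom k)) :
    jap a ≤ (1 + C⁻¹) * E ∧ jap k ≤ (1 + C⁻¹) * E := by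
  have hC' : 0 < C⁻¹ := by positivity
  -- The constant `C` enters only when `a` and `k` are opposite indices, of equal size and momentum;
  -- everywhere else both sizes are at most `E`.
  suffices hs : (jap a ≤ E ∧ jap k ≤ E) ∨ (jap a = jap k ∧ jap k ≤ C⁻¹ * E) by
    rcases hs with hs | hs <;> constructor <;> nlinarith
  obtain ⟨φ, hφ, hsep⟩ := h
  have hn : ∀ i, ‖(jap i : ℂ) ^ 2 * Complex.exp (Complex.I * φ i)‖ = jap i ^ 2 := by
    intro i
    rw [norm_mul, mul_comm Complex.I, Complex.norm_exp_ofReal_mul_I, mul_one, norm_pow,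
      Complex.norm_real, Real.norm_of_nonneg (jap_pos i).le]
  have hd : ‖(jap a : ℂ) ^ 2 * Complex.exp (Complex.I * φ a) -
      (jap k : ℂ) ^ 2 * Complex.exp (Complex.I * φ k)‖ ≤ E := by
    have h1 := hφ a
    have h2 := hφ k
    rw [norm_sub_rev] at h1
    have h3 : (jap a : ℂ) ^ 2 * Complex.exp (Complex.I * φ a) -
      (jap k : ℂ) ^ 2 * Complex.exp (Complex.I * φ k) =
      ((jap a : ℂ) ^ 2 * Complex.exp (Complex.I * φ a) - lam a) + (lam a - lam k) +
      (lam k - (jap k : ℂ) ^ 2 * Complex.exp (Complex.I * φ k)) := by ring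
    rw [h3]
    refine (norm_add₃_le).trans ?_
    linarith
  have ha1 := jap_one_le a
  have hk1 := jap_one_le k
  by_cases hjap : jap a = jap k
  swap
  · left
    have h1 := abs_norm_sub_norm_le ((jap a : ℂ) ^ 2 * Complex.exp (Complex.I * φ a))
      ((jap k : ℂ) ^ 2 * Complex.exp (Complex.I * φ k))
    rw [hn, hn] at h1
    -- Distinct sizes are distinct integers, so the difference of their squares is at least their
    -- sum.
    have h2 : 1 ≤ |jap a - jap k| := by
      rw [jap_eq_intCast, jap_eq_intCast] at hjap ⊢
      rw [← Int.cast_sub]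
      have h3 : (max |a.1| 1 : ℤ) - max |k.1| 1 ≠ 0 := fun h0 => hjap (by
        exact_mod_cast sub_eq_zero.mp h0)
      exact_mod_cast Int.one_le_abs h3
    have h3 : |jap a ^ 2 - jap k ^ 2| = |jap a - jap k| * (jap a + jap k) := by
      rw [sq_sub_sq, abs_mul, abs_of_pos (show 0 < jap a + jap k by linarith), mul_comm]
    have h4 : jap a + jap k ≤ |jap a - jap k| * (jap a + jap k) :=
      le_mul_of_one_le_left (by linarith) h2
    constructor <;> linarith
  by_cases hk : jap k = 1
  · left
    constructor <;> linarith
  have habs : ∀ i, jap i = jap k → jap i = |(mom i : ℝ)| := by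
    intro i hi
    have h1 : |(mom i : ℝ)| = |(i.1 : ℝ)| := by
      exact_mod_cast congrArg (Int.cast (R := ℝ)) (abs_mom i)
    rw [h1]
    rcases max_choice |(i.1 : ℝ)| 1 with h2 | h2
    · exact h2
    · exact absurd (hi.symm.trans h2) hk
  have h1 := habs a hjap
  have h2 := habs k rfl
  by_cases hm : mom a = mom k
  · right
    refine ⟨hjap, ?_⟩
    have hl : lam a ≠ lam k := fun hl => hne ⟨hl, hm⟩
    -- Equal momenta but different eigenvalues leave only the opposite index, for which the phases
    -- are separated by `C`.
    have hak : a = (-k.1, -k.2) := by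
      have hak : a ≠ k := fun h0 => hl (h0 ▸ rfl)
      obtain ⟨a1, a2⟩ := a
      obtain ⟨k1, k2⟩ := k
      simp only [mom] at hm
      rcases Int.units_eq_one_or a2 with rfl | rfl <;>
        rcases Int.units_eq_one_or k2 with rfl | rfl <;> simp at hm hak ⊢
      · exact absurd hm hak
      · exact hm
      · omega
      · exact absurd hm hak
    have h3 := hsep k.1 k.2 (by rw [← hak]; exact fun h0 => hl h0.symm)
    rw [← hak, norm_sub_rev] at h3
    change C ≤ ‖Complex.exp (Complex.I * φ a) - Complex.exp (Complex.I * φ k)‖ at h3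
    rw [hjap, ← mul_sub, norm_mul, norm_pow, Complex.norm_real,
      Real.norm_of_nonneg (jap_pos k).le] at hd
    have h4 : jap k * C ≤ E := by
      calc jap k * C ≤ jap k ^ 2 * C := by
            gcongr
            nlinarith
        _ ≤ jap k ^ 2 * ‖Complex.exp (Complex.I * φ a) - Complex.exp (Complex.I * φ k)‖ := by gcongr
        _ ≤ E := hd
    rw [inv_mul_eq_div, le_div_iff₀ hC]
    exact h4
  · left
    -- Equal sizes and different momenta mean opposite momenta, whose distance is `2⟨k⟩`.
    have h3 : (mom a : ℝ) = -mom k := by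
      have h4 : |(mom a : ℝ)| = |(mom k : ℝ)| := by rw [← h1, ← h2, hjap]
      rcases abs_eq_abs.mp h4 with h5 | h5
      · exact absurd (by exact_mod_cast h5) hm
      · exact h5
    have h5 : |(mom a : ℝ) - mom k| = 2 * jap k := by
      rw [h3, h2, show -(mom k : ℝ) - mom k = -(2 * mom k) by ring, abs_neg, abs_mul]
      norm_num
    constructor <;> linarith

/-- `γ` cannot be large: testing on `p = e_{(0,1)}`, where `|λ| ≤ 3/2` and the product equals `2`,
bounds it. This allows the factor `γ⁻¹` to be inserted even when the divisor is not small. -/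
theorem DiophantineMod.gamma_le {C γ τ θ : ℝ} {lam : Idx → ℂ} (hD : DiophantineMod lam γ τ)
    (hγ : 0 < γ) (hτ : τ ≤ θ) (hS : Superlinear C lam) (h0 : ∀ k, lam k ≠ 0) :
    1 ≤ γ⁻¹ * (3 / 2 * 2 ^ θ) := by
  set k : Idx := (0, 1)
  have hjap : jap k = 1 := by simp [jap, k]
  have h1 := hD.le_mul_japProd hγ hτ (p := Finsupp.single k 1) (k := k) (by simp [h0])
    (by simp [mom, k]) (by rw [← toInt_single, ← toInt_add]; exact toInt_nonneg _)
  have h2 : japProd (Finsupp.single k 1) = 2 := by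
    rw [japProd, Finsupp.prod_single_index (by simp), hjap]
    norm_num
  have h3 := norm_le_of_superlinear hS k
  rw [h2] at h1
  simp only [Finsupp.linearCombination_single, one_smul] at h1
  rw [hjap] at h3
  have h4 : 0 < ‖lam k‖ := norm_pos_iff.mpr (h0 k)
  have h5 : 1 ≤ (γ⁻¹ * 2 ^ θ) * ‖lam k‖ := (inv_le_iff_one_le_mul₀ h4).mp h1
  calc (1 : ℝ) ≤ (γ⁻¹ * 2 ^ θ) * ‖lam k‖ := h5
    _ ≤ (γ⁻¹ * 2 ^ θ) * (3 / 2 * 1 ^ 2) := by gcongr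
    _ = _ := by ring

/-- The small divisor estimate: the inverse of a nonzero divisor is controlled by the gain of
regularity. -/
theorem exists_inv_divisor_le (τ C : ℝ) (hC : 0 < C) :
    ∃ c K : ℝ, 0 < c ∧ 1 ≤ K ∧ ∀ (lam : Idx → ℂ) (γ : ℝ), 0 < γ → (∀ k, lam k ≠ 0) →
      Superlinear C lam → DiophantineMod lam γ τ → ∀ σ : ℝ, 0 < σ →
      ∀ (k : Idx) (q : Idx →₀ ℕ), q ≠ 0 → Finsupp.linearCombination ℕ mom q = mom k →
      Finsupp.linearCombination ℕ lam q ≠ lam k →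
      ‖lam k - Finsupp.linearCombination ℕ lam q‖⁻¹ ≤
        K * γ⁻¹ * Real.exp (c / σ ^ 6) * Real.exp (σ * (wt q - Real.sqrt (jap k))) := by
  set θ := max τ 1 with hθ
  have hτθ : τ ≤ θ := le_max_left _ _
  have hθ0 : 0 < θ := zero_lt_one.trans_le (le_max_right _ _)
  set S := ∑' k : Idx, (jap k ^ 2)⁻¹ with hS
  have hS0 : 0 ≤ S := tsum_nonneg fun _ => by positivity
  set D := 2 * (1 + C⁻¹) with hDdef
  have hC' : 0 < C⁻¹ := by positivity
  have hD1 : 1 ≤ D := by rw [hDdef]; linarith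
  have hl1 : 0 < logConst θ := by unfold logConst; positivity
  have hl2 : 0 < logConst (4 * θ) := by unfold logConst; positivity
  -- In `c`, the first term pays for the product over the small factors and the second for `(1 +
  -- T⁴)⁴`. In `K`, the first term collects the two factors `4⟨·⟩²` from the indices `a` and `k`,
  -- and the second comes from `DiophantineMod.gamma_le`.
  refine ⟨logConst θ * S + logConst (4 * θ), (16 * D ^ 4) ^ θ + 3 / 2 * 2 ^ θ, by positivity, ?_, ?_⟩
  · have : (1 : ℝ) ≤ 2 ^ θ := Real.one_le_rpow (by norm_num) hθ0.le
    have : 0 ≤ (16 * D ^ 4) ^ θ := by positivity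
    linarith
  intro lam γ hγ h0 hSup hDio σ hσ k q hq0 hmom hlam
  set c := logConst θ * S + logConst (4 * θ) with hc
  set K := (16 * D ^ 4) ^ θ + 3 / 2 * 2 ^ θ with hK
  have hc0 : 0 < c := by positivity
  have hK1 : (16 * D ^ 4) ^ θ ≤ K := le_add_of_nonneg_right (by positivity)
  have hK2 : 3 / 2 * 2 ^ θ ≤ K := le_add_of_nonneg_left (by positivity)
  obtain ⟨a, p, rfl, hpmax⟩ := exists_eq_add_single_max hq0
  have hmom' : Finsupp.linearCombination ℕ mom p + mom a = mom k := by simpa using hmom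
  have hlameq : Finsupp.linearCombination ℕ lam (p + Finsupp.single a 1) =
      Finsupp.linearCombination ℕ lam p + lam a := by simp
  have hgain := half_wt_le hpmax hmom'
  set T := wt p with hT
  have hT0 : 0 ≤ T := wt_nonneg p
  set G := wt (p + Finsupp.single a 1) - Real.sqrt (jap k) with hG
  have hG0 : 0 ≤ G := by linarith
  have hexpc : 1 ≤ Real.exp (c / σ ^ 6) := Real.one_le_exp (by positivity)
  have hexpG : 1 ≤ Real.exp (σ * G) := Real.one_le_exp (by positivity)
  by_cases hbig : 1 ≤ ‖lam k - Finsupp.linearCombination ℕ lam (p + Finsupp.single a 1)‖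
  · calc _ ≤ (1 : ℝ) := inv_le_one_of_one_le₀ hbig
      _ ≤ γ⁻¹ * (3 / 2 * 2 ^ θ) := hDio.gamma_le hγ hτθ hSup h0
      _ = (3 / 2 * 2 ^ θ) * γ⁻¹ * 1 * 1 := by ring
      _ ≤ _ := by gcongr
  push Not at hbig
  -- The two factors depending on `p` each cost `e^{σT/4}`, together exactly the guaranteed gain
  -- `e^{σT/2}`.
  suffices hs : ∃ P : ℝ, ‖lam k - Finsupp.linearCombination ℕ lam (p + Finsupp.single a 1)‖⁻¹ ≤
      γ⁻¹ * P ^ θ ∧ 0 ≤ P ∧ P ≤ (16 * D ^ 4) * (1 + T ^ 4) ^ 4 * japProd (toInt p) by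
    obtain ⟨P, h1, hP0, h2⟩ := hs
    have hj0 : 0 ≤ japProd (toInt p) := zero_le_one.trans (one_le_japProd _)
    have h3 : ((1 + T ^ 4) ^ 4) ^ θ ≤ Real.exp (σ / 4 * T + logConst (4 * θ) / σ ^ 6) := by
      by_cases hp : p = 0
      · have : T = 0 := by rw [hT, hp]; simp [wt]
        rw [this]
        simp only [ne_eq, OfNat.ofNat_ne_zero, not_false_eq_true, zero_pow, add_zero, one_pow,
          Real.one_rpow]
        exact Real.one_le_exp (by positivity)
      · have hT1 : 1 ≤ T := by
          obtain ⟨i, hi⟩ := Finsupp.support_nonempty_iff.mpr hp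
          exact (Real.one_le_sqrt.mpr (jap_one_le i)).trans (sqrt_jap_le_wt hi)
        have h4 := mul_log_one_add_pow_le (θ := 4 * θ) (by positivity) hσ hT1
        rw [Real.rpow_def_of_pos (by positivity), Real.log_pow]
        refine Real.exp_le_exp.mpr ?_
        have h5 : logConst (4 * θ) / σ ^ 6 * (T ^ 4)⁻¹ ≤ logConst (4 * θ) / σ ^ 6 :=
          mul_le_of_le_one_right (by positivity) (inv_le_one_of_one_le₀ (one_le_pow₀ hT1))
        push_cast
        linarith
    have h4 := japProd_rpow_le hθ0 hσ p
    calc _ ≤ γ⁻¹ * P ^ θ := h1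
      _ ≤ γ⁻¹ * ((16 * D ^ 4) * (1 + T ^ 4) ^ 4 * japProd (toInt p)) ^ θ := by gcongr
      _ = γ⁻¹ * ((16 * D ^ 4) ^ θ * ((1 + T ^ 4) ^ 4) ^ θ * japProd (toInt p) ^ θ) := by
        rw [Real.mul_rpow (by positivity) hj0, Real.mul_rpow (by positivity) (by positivity)]
      _ ≤ γ⁻¹ * (K * Real.exp (σ / 4 * T + logConst (4 * θ) / σ ^ 6) *
          Real.exp (σ / 4 * T + (logConst θ * S) / σ ^ 6)) := by gcongr
      _ = K * γ⁻¹ * (Real.exp (σ / 4 * T + logConst (4 * θ) / σ ^ 6) *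
          Real.exp (σ / 4 * T + (logConst θ * S) / σ ^ 6)) := by ring
      _ = K * γ⁻¹ * (Real.exp (c / σ ^ 6) * Real.exp (σ * (T / 2))) := by
        rw [← Real.exp_add, ← Real.exp_add, hc]
        congr 2
        ring
      _ ≤ K * γ⁻¹ * (Real.exp (c / σ ^ 6) * Real.exp (σ * G)) := by gcongr
      _ = _ := by ring
  -- For a resonant pair, `λ_a` and `λ_k` cancel in the divisor, and the Diophantine condition is
  -- applied to `p` alone.
  by_cases hres : lam a = lam k ∧ mom a = mom k
  · refine ⟨japProd (toInt p), ?_, zero_le_one.trans (one_le_japProd _), ?_⟩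
    · have h1 := hDio.le_mul_japProd hγ hτθ (p := toInt p) (k := k) (by
        rw [linearCombination_toInt]
        intro h
        rw [hlameq, h, zero_add] at hlam
        exact hlam hres.1) (by
        rw [linearCombination_toInt]
        linarith [hres.2]) (by
        rw [← toInt_single, ← toInt_add]
        exact toInt_nonneg _)
      rw [hlameq, hres.1, sub_add_cancel_right, norm_neg]
      rwa [linearCombination_toInt] at h1
    · have h1 := one_le_japProd (toInt p)
      have h2 : 1 ≤ D ^ 4 := one_le_pow₀ hD1
      have h3 : 1 ≤ (1 + T ^ 4) ^ 4 := one_le_pow₀ (le_add_of_nonneg_right (by positivity))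
      have h4 : 1 ≤ (16 * D ^ 4) * (1 + T ^ 4) ^ 4 :=
        one_le_mul_of_one_le_of_one_le (by linarith) h3
      exact le_mul_of_one_le_left (by linarith) h4
  -- A divisor below `1` and `|λ · p| ≤ 3/2 T⁴` give `|λ_a - λ_k| ≤ E - 1`.
  · set E := 2 + 3 / 2 * T ^ 4 with hE
    have hT4 : 0 ≤ T ^ 4 := by positivity
    have h1 : ‖lam a - lam k‖ ≤ E - 1 := by
      have h2 : lam a - lam k = -(lam k - Finsupp.linearCombination ℕ lam (p + Finsupp.single a 1)) -
          Finsupp.linearCombination ℕ lam p := by rw [hlameq]; ring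
      rw [h2]
      refine (norm_sub_le _ _).trans ?_
      rw [norm_neg]
      linarith [norm_linearCombination_le hSup p]
    have h2 : |(mom a : ℝ) - mom k| ≤ E := by
      have h3 : (mom a : ℝ) - mom k = -((Finsupp.linearCombination ℕ mom p : ℤ) : ℝ) := by
        rw [← hmom']
        push_cast
        ring
      rw [h3, abs_neg]
      refine (abs_linearCombination_mom_le p).trans ?_
      have h4 := sum_jap_pow_le p 0
      simp only [zero_add, pow_one, mul_one] at h4
      nlinarith [sq_nonneg (T ^ 2 - 1)]
    obtain ⟨hA, hB⟩ := jap_le_of_superlinear hC hSup (by linarith) h1 h2 hres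
    have hER : (1 + C⁻¹) * E ≤ D * (1 + T ^ 4) := by
      rw [hE, hDdef]
      nlinarith
    have ha0 := jap_pos a
    have hk0 := jap_pos k
    set p' := toInt p + Finsupp.single a 1 + Finsupp.single k (-1) with hp'
    have hp'k : p' + Finsupp.single k 1 = toInt (p + Finsupp.single a 1) := by
      rw [hp', add_assoc, ← Finsupp.single_add, toInt_add, toInt_single]
      simp
    have hlc : ∀ {E : Type} [AddCommGroup E] (v : Idx → E),
        Finsupp.linearCombination ℤ v p' =
          Finsupp.linearCombination ℕ v (p + Finsupp.single a 1) - v k := by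
      intro E _ v
      rw [eq_sub_iff_add_eq, ← linearCombination_toInt, ← hp'k, map_add _ p']
      simp
    refine ⟨japProd p', ?_, zero_le_one.trans (one_le_japProd _), ?_⟩
    · have h3 := hDio.le_mul_japProd hγ hτθ (p := p') (k := k) (by
        rw [hlc]
        exact sub_ne_zero.mpr hlam) (by
        rw [hlc, hmom, sub_self]) (by
        rw [hp'k]
        exact toInt_nonneg _)
      rw [hlc] at h3
      rwa [norm_sub_rev]
    · have h3 := japProd_add_single_le (toInt p) a (e := 1) (by norm_num)
      have h4 := japProd_add_single_le (toInt p + Finsupp.single a 1) k (e := -1) (by norm_num)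
      have hj0 : 0 ≤ japProd (toInt p) := zero_le_one.trans (one_le_japProd _)
      calc japProd p' ≤ 4 * jap k ^ 2 * (4 * jap a ^ 2 * japProd (toInt p)) :=
            h4.trans (by gcongr)
        _ ≤ 4 * (D * (1 + T ^ 4)) ^ 2 * (4 * (D * (1 + T ^ 4)) ^ 2 * japProd (toInt p)) := by
            have hA' := hA.trans hER
            have hB' := hB.trans hER
            gcongr
        _ = _ := by ring

/-! ### Solution of the homological equation -/

/-- Raising `s` shrinks the ball but strengthens the target norm; momentum conservation gives `√⟨k⟩
≤ wt q`, so the first effect prevails. -/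
theorem majNorm_le_of_momentumPreserving {s r σ : ℝ} (hr : 0 < r) (hσ : 0 ≤ σ) {V : FormalVF}
    (hV : MomentumPreserving V) (hord : OrderGE 0 V) : majNorm (s + σ) r V ≤ majNorm s r V := by
  have h := majNorm_le_of_coeff_le (s := s) (σ := σ) hr (V := V) (W := V) zero_le_one
    (fun k q hq => by
      have hq0 : q ≠ 0 := by
        rintro rfl
        simpa using hord k 0 hq
      have h1 : 1 ≤ Real.exp (σ * (wt q - Real.sqrt (jap k))) :=
        Real.one_le_exp (mul_nonneg hσ (sub_nonneg.mpr (sqrt_jap_le_wt_of_mom hq0 (hV k q hq))))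
      rw [one_mul]
      exact le_mul_of_one_le_left (norm_nonneg _) h1)
  simpa using h

theorem OrderGE.mono {d d' : ℕ} (h : d ≤ d') {V : FormalVF} (hV : OrderGE d' V) : OrderGE d V :=
  fun k q hq => by
    have := hV k q hq
    omega

theorem OrderGE.cf_zero {d : ℕ} {V : FormalVF} (hV : OrderGE d V) (k : Idx) : cf V k 0 = 0 := by
  by_contra h
  simpa using hV k 0 h

/-- The fields in `ℐ⁽ⁱ⁾` of order at least `d`. -/
structure IdealField (lam : Idx → ℂ) (i : Fin 2) (d : ℕ) (V : FormalVF) : Prop where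
  momentum : MomentumPreserving V
  ideal : InIdeal lam i V
  order : OrderGE d V

/-- The operator `F ↦ Π (F[Z])`. -/
def transport (lam : Idx → ℂ) (i : Fin 2) (Z F : FormalVF) : FormalVF :=
  proj (idealExp lam i) fun j => applyVF F (Z j)

/-- Division of the coefficients by `λ_k - λ · q`, the eigenvalues of `[·, D(λ)]`. -/
def divLam (lam : Idx → ℂ) (V : FormalVF) : FormalVF :=
  fun k q => (lam k - Finsupp.linearCombination ℕ lam q)⁻¹ * cf V k q

theorem cf_divLam (lam : Idx → ℂ) (V : FormalVF) (k : Idx) (q : Idx →₀ ℕ) :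
    cf (divLam lam V) k q = (lam k - Finsupp.linearCombination ℕ lam q)⁻¹ * cf V k q := rfl

theorem cf_sub (V W : FormalVF) (k : Idx) (q : Idx →₀ ℕ) :
    cf (V - W) k q = cf V k q - cf W k q := by
  simp [cf]

theorem cf_ext {V W : FormalVF} (h : ∀ k q, cf V k q = cf W k q) : V = W := by
  funext k
  ext q
  exact h k q

open Classical in
theorem cf_proj (J : Set (Idx →₀ ℕ)) (V : FormalVF) (k : Idx) (q : Idx →₀ ℕ) :
    cf (proj J V) k q = if q ∈ J then cf V k q else 0 := rfl

section

variable {lam : Idx → ℂ} {i : Fin 2} {d : ℕ} {V W Z : FormalVF}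

theorem cf_ne_zero_of_divLam {k : Idx} {q : Idx →₀ ℕ} (h : cf (divLam lam V) k q ≠ 0) :
    cf V k q ≠ 0 :=
  right_ne_zero_of_mul h

theorem IdealField.divLam (hV : IdealField lam i d V) : IdealField lam i d (divLam lam V) where
  momentum k q h := hV.momentum k q (cf_ne_zero_of_divLam h)
  ideal k q h := hV.ideal k q (cf_ne_zero_of_divLam h)
  order k q h := hV.order k q (cf_ne_zero_of_divLam h)

theorem IdealField.sub (hV : IdealField lam i d V) (hW : IdealField lam i d W) :
    IdealField lam i d (V - W) := by
  have h : ∀ k q, cf (V - W) k q ≠ 0 → cf V k q ≠ 0 ∨ cf W k q ≠ 0 := by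
    intro k q h
    by_contra! hc
    rw [cf_sub, hc.1, hc.2, sub_zero] at h
    exact h rfl
  exact ⟨fun k q hq => (h k q hq).elim (hV.momentum k q) (hW.momentum k q),
    fun k q hq => (h k q hq).elim (hV.ideal k q) (hW.ideal k q),
    fun k q hq => (h k q hq).elim (hV.order k q) (hW.order k q)⟩

theorem IdealField.transport (hV : IdealField lam i d V) (hZ : MomentumPreserving Z) :
    IdealField lam i d (transport lam i Z V) := by
  have h : ∀ k q, cf (ResVF.transport lam i Z V) k q ≠ 0 →
      q ∈ idealExp lam i ∧ cf (fun j => applyVF V (Z j)) k q ≠ 0 := by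
    intro k q h
    rw [ResVF.transport, cf_proj] at h
    split_ifs at h with hq
    · exact ⟨hq, h⟩
    · exact absurd rfl h
  exact ⟨fun k q hq => hV.momentum.applyVF hZ k q (h k q hq).2, fun k q hq => (h k q hq).1,
    fun k q hq => hV.order.applyVF k q (h k q hq).2⟩

theorem transport_sub (hV : MomentumPreserving V) (hW : MomentumPreserving W) :
    transport lam i Z (V - W) = transport lam i Z V - transport lam i Z W := by
  refine cf_ext fun k q => ?_
  rw [cf_sub]
  simp only [transport, cf_proj]
  split_ifs
  · simp only [cf, applyVF_sub_left hV hW, map_sub]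
  · simp

theorem IdealField.sub_ne_zero (hV : IdealField lam i d V) (hd : IsThreshold lam d) {k : Idx}
    {q : Idx →₀ ℕ} (h : cf V k q ≠ 0) : lam k - Finsupp.linearCombination ℕ lam q ≠ 0 :=
  _root_.sub_ne_zero.mpr (hd.linearCombination_ne (hV.ideal k q h) (hV.momentum k q h)
    (hV.order k q h)).symm

theorem IdealField.mul_cf_divLam (hV : IdealField lam i d V) (hd : IsThreshold lam d) (k : Idx)
    (q : Idx →₀ ℕ) :
    (lam k - Finsupp.linearCombination ℕ lam q) * cf (ResVF.divLam lam V) k q = cf V k q := by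
  rw [cf_divLam]
  by_cases h : cf V k q = 0
  · simp [h]
  · rw [mul_inv_cancel_left₀ (hV.sub_ne_zero hd h)]

/-- The solution `L⁻¹ Y - L⁻¹ Π ((L⁻¹ Y)[Z])` of the homological equation. -/
def homSol (lam : Idx → ℂ) (i : Fin 2) (Z Y : FormalVF) : FormalVF :=
  divLam lam Y - divLam lam (transport lam i Z (divLam lam Y))

theorem IdealField.homSol {Y : FormalVF} (hY : IdealField lam i d Y) (hZ : MomentumPreserving Z) :
    IdealField lam i d (homSol lam i Z Y) :=
  hY.divLam.sub (hY.divLam.transport hZ).divLam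

/-- A Neumann series that stops after two terms: applying `A` to the correction term gives `A L⁻¹ A
L⁻¹ Y = 0`. -/
theorem proj_lie_homSol {Y : FormalVF} (hY : IdealField lam i d Y) (hd : IsThreshold lam d)
    (hmom : MomentumPreserving Z)
    (hZ : ∀ k q, cf Z k q ≠ 0 → ∃ p ∈ MLat lam, p ≠ 0 ∧ q = p + Finsupp.single k 1) :
    proj (idealExp lam i) (lie (homSol lam i Z Y) (diagField lam + Z)) = Y := by
  have hF := hY.homSol hmom
  have hA := hY.divLam.transport (lam := lam) hmom
  have hAA : transport lam i Z (divLam lam (transport lam i Z (divLam lam Y))) = 0 :=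
    proj_applyVF_proj_applyVF hY.divLam.ideal hZ fun k q => cf_ne_zero_of_divLam
  have hT : transport lam i Z (homSol lam i Z Y) = transport lam i Z (divLam lam Y) := by
    rw [homSol, transport_sub hY.divLam.momentum hA.divLam.momentum, hAA, sub_zero]
  refine cf_ext fun k q => ?_
  rw [cf_proj_lie hF.momentum hF.ideal hmom hZ]
  change _ + cf (transport lam i Z (homSol lam i Z Y)) k q = _
  rw [hT, homSol, cf_sub, mul_sub, hY.mul_cf_divLam hd, hA.mul_cf_divLam hd, sub_add_cancel]

/-- The difference `H` satisfies `L H = -A H` with nonzero divisors, so its support lies in that of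
`A H`. The nilpotency statement then gives `A H = 0`, hence `L H = 0` and `H = 0`; no norm is
involved. -/
theorem eq_of_proj_lie_eq {F G : FormalVF} (hF : IdealField lam i d F) (hG : IdealField lam i d G)
    (hd : IsThreshold lam d) (hmom : MomentumPreserving Z)
    (hZ : ∀ k q, cf Z k q ≠ 0 → ∃ p ∈ MLat lam, p ≠ 0 ∧ q = p + Finsupp.single k 1)
    (h : proj (idealExp lam i) (lie G (diagField lam + Z)) =
      proj (idealExp lam i) (lie F (diagField lam + Z))) : G = F := by
  have hH := hG.sub hF
  have h1 : ∀ k q, (lam k - Finsupp.linearCombination ℕ lam q) * cf (G - F) k q +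
      cf (transport lam i Z (G - F)) k q = 0 := by
    intro k q
    have h2 := congrArg (fun V => cf V k q) h
    rw [cf_proj_lie hF.momentum hF.ideal hmom hZ, cf_proj_lie hG.momentum hG.ideal hmom hZ] at h2
    change _ + cf (transport lam i Z G) k q = _ + cf (transport lam i Z F) k q at h2
    rw [transport_sub hG.momentum hF.momentum, cf_sub, cf_sub]
    linear_combination h2
  have h3 : transport lam i Z (G - F) = 0 := by
    refine proj_applyVF_proj_applyVF hH.ideal hZ fun k q hq h0 => ?_
    have h4 := h1 k q
    change cf (transport lam i Z (G - F)) k q = 0 at h0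
    rw [h0, add_zero] at h4
    exact (mul_ne_zero (hH.sub_ne_zero hd hq) hq) h4
  refine cf_ext fun k q => ?_
  by_contra hne
  have h4 : cf (G - F) k q ≠ 0 := by
    rw [cf_sub]
    exact _root_.sub_ne_zero.mpr hne
  have h5 := h1 k q
  rw [h3, show cf (0 : FormalVF) k q = 0 by simp [cf], add_zero] at h5
  exact (mul_ne_zero (hH.sub_ne_zero hd h4) h4) h5

theorem majNorm_transport_le {s r ρ : ℝ} (hρ : 0 < ρ) (hρr : ρ < r)
    (hV : majNorm s (r - ρ) V < ⊤) :
    majNorm s (r - ρ) (transport lam i Z V) ≤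
      ENNReal.ofReal (r / ρ) * majNorm s (r - ρ) V * majNorm s r Z := by
  refine le_trans ?_ (majNorm_applyVF_le hρ hρr hV)
  have h := majNorm_le_of_coeff_le (s := s) (σ := 0) (sub_pos.mpr hρr)
    (V := fun j => applyVF V (Z j)) (W := transport lam i Z V) zero_le_one (fun k q _ => by
      rw [transport, cf_proj]
      split_ifs <;> simp)
  simpa using h

end

theorem majNorm_divLam_le {lam : Idx → ℂ} {i : Fin 2} {d : ℕ} {V : FormalVF}
    (hd : IsThreshold lam d) (hV : IdealField lam i d V) {s r σ B : ℝ} (hr : 0 < r) (hB : 0 ≤ B)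
    (h : ∀ (k : Idx) (q : Idx →₀ ℕ), q ≠ 0 → Finsupp.linearCombination ℕ mom q = mom k →
      Finsupp.linearCombination ℕ lam q ≠ lam k →
      ‖lam k - Finsupp.linearCombination ℕ lam q‖⁻¹ ≤
        B * Real.exp (σ * (wt q - Real.sqrt (jap k)))) :
    majNorm (s + σ) r (divLam lam V) ≤ ENNReal.ofReal B * majNorm s r V := by
  refine majNorm_le_of_coeff_le hr hB fun k q hq => ?_
  have hq' := cf_ne_zero_of_divLam hq
  rw [cf_divLam, norm_mul, norm_inv]
  gcongr
  refine h k q ?_ (hV.momentum k q hq') fun h0 => hV.sub_ne_zero hd hq' (sub_eq_zero.mpr h0.symm)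
  rintro rfl
  exact hq' (hV.order.cf_zero k)

/-- The estimate of the solution of the homological equation. -/
theorem majNorm_homSol_le {lam : Idx → ℂ} {i : Fin 2} {d : ℕ} {Y Z : FormalVF}
    (hd : IsThreshold lam d) (hY : IdealField lam i d Y) (hZ : MomentumPreserving Z)
    (hZo : OrderGE 0 Z) {s r ρ σ γ c K : ℝ} (hρ : 0 < ρ) (hρr : ρ < r) (hσ : 0 < σ)
    (hγ : 0 < γ) (hc : 0 ≤ c) (hK : 1 ≤ K)
    (hYfin : majNorm s r Y < ⊤)
    (h : ∀ σ : ℝ, 0 < σ → ∀ (k : Idx) (q : Idx →₀ ℕ), q ≠ 0 →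
      Finsupp.linearCombination ℕ mom q = mom k → Finsupp.linearCombination ℕ lam q ≠ lam k →
      ‖lam k - Finsupp.linearCombination ℕ lam q‖⁻¹ ≤
        K * γ⁻¹ * Real.exp (c / σ ^ 6) * Real.exp (σ * (wt q - Real.sqrt (jap k)))) :
    majNorm (s + σ) (r - ρ) (homSol lam i Z Y) ≤
      ENNReal.ofReal (K ^ 2 * (r / ρ) * γ⁻¹ * Real.exp (2 ^ 7 * c / σ ^ 6)) *
        (1 + ENNReal.ofReal γ⁻¹ * majNorm s r Z) * majNorm s r Y := by
  have hr : 0 < r := hρ.trans hρr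
  have hr' : 0 < r - ρ := sub_pos.mpr hρr
  -- Each of the two divisions spends `σ/2`; the square of `e^{c/(σ/2)⁶}` is the origin of `2⁷`. The
  -- radius is reduced only once.
  have hσ2 : 0 < σ / 2 := by positivity
  set b := K * γ⁻¹ * Real.exp (c / (σ / 2) ^ 6) with hb
  have hb0 : 0 ≤ b := by positivity
  have hA := hY.divLam.transport (lam := lam) hZ
  have h1 : majNorm (s + σ / 2) (r - ρ) (divLam lam Y) ≤ ENNReal.ofReal b * majNorm s r Y :=
    (majNorm_divLam_le hd hY hr' hb0 (h (σ / 2) hσ2)).trans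
      (mul_le_mul_right (majNorm_radius_mono hr' (by linarith) hY.order.cf_zero) _)
  have h2 : majNorm (s + σ / 2) (r - ρ) (transport lam i Z (divLam lam Y)) ≤
      ENNReal.ofReal (r / ρ) * (ENNReal.ofReal b * majNorm s r Y) * majNorm s r Z := by
    refine (majNorm_transport_le hρ hρr
      (h1.trans_lt (ENNReal.mul_lt_top ENNReal.ofReal_lt_top hYfin))).trans ?_
    gcongr
    exact majNorm_le_of_momentumPreserving hr hσ2.le hZ hZo
  have hs : s + σ = s + σ / 2 + σ / 2 := by ring
  have h3 : majNorm (s + σ) (r - ρ) (divLam lam (transport lam i Z (divLam lam Y))) ≤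
      ENNReal.ofReal b *
        (ENNReal.ofReal (r / ρ) * (ENNReal.ofReal b * majNorm s r Y) * majNorm s r Z) := by
    rw [hs]
    exact (majNorm_divLam_le hd hA hr' hb0 (h (σ / 2) hσ2)).trans (mul_le_mul_right h2 _)
  have h4 : majNorm (s + σ) (r - ρ) (divLam lam Y) ≤ ENNReal.ofReal b * majNorm s r Y := by
    rw [hs]
    exact (majNorm_le_of_momentumPreserving hr' hσ2.le hY.divLam.momentum
      (hY.divLam.order.mono (Nat.zero_le _))).trans h1
  set B := K ^ 2 * (r / ρ) * γ⁻¹ * Real.exp (2 ^ 7 * c / σ ^ 6) with hB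
  have hrρ : 1 ≤ r / ρ := (one_le_div hρ).mpr hρr.le
  have he : Real.exp (c / (σ / 2) ^ 6) ^ 2 = Real.exp (2 ^ 7 * c / σ ^ 6) := by
    rw [← Real.exp_nat_mul]
    congr 1
    field_simp
    norm_num
    ring
  have he1 : 1 ≤ Real.exp (c / (σ / 2) ^ 6) := Real.one_le_exp (by positivity)
  -- The term with a single division is padded to the common constant, using `K ≥ 1` and `r/ρ ≥ 1`.
  have hbB : b ≤ B := by
    rw [hB, ← he, hb]
    calc K * γ⁻¹ * Real.exp (c / (σ / 2) ^ 6) = K * 1 * γ⁻¹ * Real.exp (c / (σ / 2) ^ 6) := by ring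
      _ ≤ K ^ 2 * (r / ρ) * γ⁻¹ * Real.exp (c / (σ / 2) ^ 6) ^ 2 := by
        gcongr
        · exact le_self_pow₀ hK (by norm_num)
        · exact le_self_pow₀ he1 (by norm_num)
  have hbbB : b * (r / ρ) * b = B * γ⁻¹ := by
    rw [hB, ← he, hb]
    ring
  have hB0 : 0 ≤ B := hb0.trans hbB
  clear_value b B
  calc majNorm (s + σ) (r - ρ) (homSol lam i Z Y)
      ≤ ENNReal.ofReal b * majNorm s r Y + ENNReal.ofReal b *
        (ENNReal.ofReal (r / ρ) * (ENNReal.ofReal b * majNorm s r Y) * majNorm s r Z) :=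
        (majNorm_sub_le hr' _ _).trans (add_le_add h4 h3)
    _ = ENNReal.ofReal b * majNorm s r Y +
        ENNReal.ofReal (b * (r / ρ) * b) * majNorm s r Z * majNorm s r Y := by
        rw [ENNReal.ofReal_mul (p := b * (r / ρ)) (by positivity), ENNReal.ofReal_mul hb0]
        ring
    _ ≤ ENNReal.ofReal B * majNorm s r Y +
        ENNReal.ofReal (B * γ⁻¹) * majNorm s r Z * majNorm s r Y := by
        rw [hbbB]
        gcongr
    _ = _ := by
        rw [ENNReal.ofReal_mul hB0]
        ring

end ResVF

end

/-! ### Assembly of the proposition -/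

theorem proposition4p1 (τ C : ℝ) (hC : 0 < C) :
    ∃ c K : ℝ, 0 < c ∧ 0 < K ∧
      ∀ (lam : ResVF.Idx → ℂ) (M M₁ : ℕ) (γ : ℝ), 0 < M → 0 < γ →
        (∀ k, lam k ≠ 0) →
        ResVF.BoundedGenerators lam M M₁ →
        ResVF.Superlinear C lam →
        ResVF.DiophantineMod lam γ τ →
        ResVF.IsThreshold lam (2 * M + M₁) ∧
        ∀ Mst : ℕ, ResVF.IsThreshold lam Mst →
          ∀ (s r : ℝ), 0 ≤ s → 0 < r →
          ∀ Z : ResVF.FormalVF, ResVF.MemV s r Z → ResVF.Resonant lam Z → ResVF.Diagonal Z →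
            ResVF.OrderGE 1 Z →
          ∀ (i : Fin 2) (Y : ResVF.FormalVF), ResVF.MemV s r Y → ResVF.InIdeal lam i Y →
            ResVF.OrderGE Mst Y →
          ∃ F : ResVF.FormalVF, ∀ (σ ρ : ℝ), 0 < σ → 0 < ρ → ρ < r →
            (ResVF.MemV (s + σ) (r - ρ) F ∧ ResVF.InIdeal lam i F ∧ ResVF.OrderGE Mst F ∧
              ResVF.proj (ResVF.idealExp lam i)
                (ResVF.lie F (ResVF.diagField lam + Z)) = Y ∧
              ResVF.majNorm (s + σ) (r - ρ) F ≤
                ENNReal.ofReal (K * (r / ρ) * γ⁻¹ * Real.exp (2 ^ 7 * c / σ ^ 6)) *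
                  (1 + ENNReal.ofReal γ⁻¹ * ResVF.majNorm s r Z) * ResVF.majNorm s r Y) ∧
            ∀ G : ResVF.FormalVF, ResVF.MemV (s + σ) (r - ρ) G → ResVF.InIdeal lam i G →
              ResVF.OrderGE Mst G →
              ResVF.proj (ResVF.idealExp lam i)
                (ResVF.lie G (ResVF.diagField lam + Z)) = Y → G = F := by
  obtain ⟨c, K, hc, hK, hdiv⟩ := ResVF.exists_inv_divisor_le τ C hC
  -- The square accounts for the two divisions in `homSol`.
  refine ⟨c, K ^ 2, hc, by positivity, ?_⟩
  intro lam M M₁ γ hM hγ h0 hB hS hD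
  refine ⟨ResVF.isThreshold_of_boundedGenerators hM hB, ?_⟩
  intro Mst hMst s r _ _ Z hZ hZres hZdiag hZord i Y hY hYI hYord
  have hYF : ResVF.IdealField lam i Mst Y := ⟨hY.momentum, hYI, hYord⟩
  have hZ' : ∀ k q, ResVF.cf Z k q ≠ 0 →
      ∃ p ∈ ResVF.MLat lam, p ≠ 0 ∧ q = p + Finsupp.single k 1 := fun k q =>
    ResVF.exists_MLat_of_diagonal hZ.momentum hZres hZdiag hZord
  have hF := hYF.homSol (Z := Z) hZ.momentum
  have heq := ResVF.proj_lie_homSol hYF hMst hZ.momentum hZ'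
  -- The formal solution is fixed before `σ` and `ρ`, so one field serves for all of them.
  refine ⟨ResVF.homSol lam i Z Y, fun σ ρ hσ hρ hρr => ?_⟩
  have hnorm := ResVF.majNorm_homSol_le hMst hYF hZ.momentum (hZord.mono (Nat.zero_le _)) hρ hρr hσ
    hγ hc.le hK hY.finite (hdiv lam γ hγ h0 hS hD)
  refine ⟨⟨⟨hF.order.cf_zero, hF.momentum, hnorm.trans_lt ?_⟩, hF.ideal, hF.order, heq, hnorm⟩, ?_⟩
  · exact ENNReal.mul_lt_top (ENNReal.mul_lt_top ENNReal.ofReal_lt_top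
      (ENNReal.add_lt_top.mpr ⟨ENNReal.one_lt_top,
        ENNReal.mul_lt_top ENNReal.ofReal_lt_top hZ.finite⟩)) hY.finite
  · intro G hG hGI hGord hGeq
    exact ResVF.eq_of_proj_lie_eq hF ⟨hG.momentum, hGI, hGord⟩ hMst hZ.momentum hZ'
      (hGeq.trans heq.symm)
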